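/- Let $X$ be a finite set and let $X^*$ be the set of finite words over $X$, viewed as a rooted tree. Write $u\sqsubseteq v$ if $u$ is a prefix of $v$, and $X^n$ for the set of words of length $n$. Let $\mathrm{Aut}(X^*)$ be the group of bijections of $X^*$ that preserve the prefix relation in both directions. For $g\in\mathrm{Aut}(X^*)$ and $u\in X^*$, the section $g_u\in\mathrm{Aut}(X^*)$ is defined by $g(uw)=g(u)\,g_u(w)$ for all $w\in X^*$, and $\psi_u(g):=g_u$. For $H\le\mathrm{Aut}(X^*)$, $Y\subseteq X^*$ and $n\ge 0$, let $\mathrm{st}_H(Y)$ be the pointwise stabilizer of $Y$ in $H$, let $\mathrm{st}_H(n):=\mathrm{st}_H(X^n)$, let $\mathrm{rist}_H(x)$ be the subgroup of those elements of $H$ that fix every word not having $x$ as a prefix, and let $\mathrm{rist}_H(n):=\langle \mathrm{rist}_H(x)\mid x\in X^n\rangle$. A spanning leaf set is a finite set $Y\subseteq X^*$ in which no element is a prefix of another one and such that, for some $N$, every word of length at least $N$ has a prefix in $Y$. For a spanning leaf set $Y$ and $G\le\mathrm{Aut}(X^*)$, the group $\mathrm{st}_H(Y)$ is an infra-direct product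 of $G^Y$ if, for every $y\in Y$, $\psi_y(\mathrm{st}_H(Y))$ is a finite index subgroup of $G$. Let $G\le\mathrm{Aut}(X^*)$ be a finitely generated group such that: 1. $G$ is a branch group: $G$ acts transitively on $X^n$, and $\mathrm{rist}_G(n)$ has finite index in $G$, for every $n\ge 0$; 2. $G$ is just infinite: $G$ is infinite and every quotient of $G$ by a non-trivial normal subgroup is finite; 3. $G$ is strongly self-replicating: $g_x\in G$ for all $g\in G$ and $x\in X^*$, and $\psi_x(\mathrm{st}_G(n))=G$ for all $n\ge 1$ and $x\in X^n$; 4. $G$ has well-approximated subgroups: $\bigcap_{n\ge 0}H\,\mathrm{st}_G(n)=H$ for every finitely generated $H\le G$; 5. $G$ obeys the Grigorchuk–Nagnibeda alternative: for every finitely generated $H\le G$, either there is $y\in X^*$ such that $\psi_y(H)=\{h_y\mid h\in H\}$ is finite, or there is a spanning leaf set $Y\subseteq X^*$ such that $\mathrm{st}_H(Y)$ is an infra-direct product of $G^Y$. Let $\mathrm{Sub}(G)$ be the space of subgroups of $G$ with the topology induced from the product topology on $\{0,1\}^G$. Then the Cantor–Bendixson rank of $\mathrm{Sub}(G)$ is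 exactly $\omega$. Here the Cantor–Bendixson derivatives of a space $S$ are $S^0:=S$, $S^{\alpha+1}:=$ the set of limit points of $S^\alpha$ in $S^\alpha$, and $S^\lambda:=\bigcap_{\alpha<\lambda}S^\alpha$ for limit ordinals $\lambda$; the rank of $S$ is the least ordinal $\alpha$ with $S^\alpha=S^{\alpha+1}$. -/

import Mathlib

open scoped Pointwise

/-! ### The rooted tree `X^*` and its automorphisms -/

/-- `Aut(X^*)`: the bijections of the set of words `X^*` that preserve the prefix relation in both
directions. The group law is composition, `(g * h) w = g (h w)`. -/
abbrev TreeAut (X : Type*) : Type _ :=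
  (List.IsPrefix : List X → List X → Prop) ≃r (List.IsPrefix : List X → List X → Prop)

namespace TreeAut

variable {X : Type*}

/-- The action of the section `g_u` on words: `g (u w)` with its prefix `g u` removed. -/
def sectionFun (g : TreeAut X) (u w : List X) : List X :=
  (g (u ++ w)).drop (g u).length

theorem apply_append_sectionFun (g : TreeAut X) (u w : List X) :
    g (u ++ w) = g u ++ g.sectionFun u w := by
  obtain ⟨t, ht⟩ := g.map_rel_iff.2 (List.prefix_append u w)
  unfold sectionFun
  rw [← ht, List.drop_left]

theorem sectionFun_inv_left (g : TreeAut X) (u w : List X) :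
    (g⁻¹).sectionFun (g u) (g.sectionFun u w) = w := by
  have h := (g⁻¹).apply_append_sectionFun (g u) (g.sectionFun u w)
  rw [← apply_append_sectionFun, RelIso.inv_apply_self, RelIso.inv_apply_self] at h
  exact (List.append_cancel_left h).symm

theorem sectionFun_inv_right (g : TreeAut X) (u w : List X) :
    g.sectionFun u ((g⁻¹).sectionFun (g u) w) = w := by
  have h := (g⁻¹).sectionFun_inv_left (g u) w
  rwa [inv_inv, RelIso.inv_apply_self] at h

/-- The section `g_u` of `g` at the vertex `u`, characterized by `g (u w) = g u · g_u w`. -/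
def sectionAt (g : TreeAut X) (u : List X) : TreeAut X where
  toFun := g.sectionFun u
  invFun := (g⁻¹).sectionFun (g u)
  left_inv := g.sectionFun_inv_left u
  right_inv := g.sectionFun_inv_right u
  map_rel_iff' := by
    intro v w
    change g.sectionFun u v <+: g.sectionFun u w ↔ v <+: w
    rw [← List.prefix_append_right_inj (g u), ← apply_append_sectionFun,
      ← apply_append_sectionFun, g.map_rel_iff, List.prefix_append_right_inj]

theorem apply_append (g : TreeAut X) (u w : List X) :
    g (u ++ w) = g u ++ g.sectionAt u w :=
  g.apply_append_sectionFun u w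

theorem sectionAt_one (u : List X) : (1 : TreeAut X).sectionAt u = 1 := by
  ext1 w
  have h := (1 : TreeAut X).apply_append u w
  simp only [RelIso.one_apply] at h ⊢
  exact (List.append_cancel_left h).symm

theorem sectionAt_mul (g h : TreeAut X) (u : List X) :
    (g * h).sectionAt u = g.sectionAt (h u) * h.sectionAt u := by
  ext1 w
  have e := (g * h).apply_append u w
  rw [RelIso.mul_apply, RelIso.mul_apply, h.apply_append, g.apply_append] at e
  exact (List.append_cancel_left e).symm

/-! ### Stabilizers -/

/-- `st_H(Y)`: the pointwise stabilizer in `H` of a set `Y` of vertices. -/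
def st (H : Subgroup (TreeAut X)) (Y : Set (List X)) : Subgroup (TreeAut X) where
  carrier := {g | g ∈ H ∧ ∀ y ∈ Y, g y = y}
  one_mem' := ⟨H.one_mem, fun _ _ => rfl⟩
  mul_mem' := by
    rintro a b ⟨ha, ha'⟩ ⟨hb, hb'⟩
    exact ⟨H.mul_mem ha hb, fun y hy => by rw [RelIso.mul_apply, hb' y hy, ha' y hy]⟩
  inv_mem' := by
    rintro a ⟨ha, ha'⟩
    refine ⟨H.inv_mem ha, fun y hy => ?_⟩
    conv_lhs => rw [← ha' y hy]
    exact a.inv_apply_self y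

/-- The level `X^n`: the words of length `n`. -/
def level (X : Type*) (n : ℕ) : Set (List X) := {w | w.length = n}

/-- `rist_G(x)`: the elements of `G` fixing every vertex outside the subtree rooted at `x`. -/
def ristVertex (G : Subgroup (TreeAut X)) (x : List X) : Subgroup (TreeAut X) :=
  st G {v | ¬ x <+: v}

/-- `rist_G(n)`: the subgroup generated by the rigid stabilizers of the vertices of level `n`. -/
def ristLevel (G : Subgroup (TreeAut X)) (n : ℕ) : Subgroup (TreeAut X) :=
  ⨆ x ∈ level X n, ristVertex G x

/-! ### Classes of subgroups of `Aut(X^*)` -/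

/-- Branch groups: transitive on every level, with all rigid level stabilizers of finite index. -/
def IsBranch (G : Subgroup (TreeAut X)) : Prop :=
  (∀ n : ℕ, ∀ u ∈ level X n, ∀ v ∈ level X n, ∃ g ∈ G, g u = v) ∧
    ∀ n : ℕ, (ristLevel G n).IsFiniteRelIndex G

/-- Self-similar groups: closed under taking sections. -/
def IsSelfSimilar (G : Subgroup (TreeAut X)) : Prop :=
  ∀ g ∈ G, ∀ x : List X, g.sectionAt x ∈ G

/-- Strongly self-replicating groups: self-similar, with `ψ_x(st_G(n)) = G` for all `n ≥ 1` and
all `x` of level `n`. -/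
def IsStronglySelfReplicating (G : Subgroup (TreeAut X)) : Prop :=
  IsSelfSimilar G ∧
    ∀ n : ℕ, 1 ≤ n → ∀ x ∈ level X n,
      (fun g : TreeAut X => g.sectionAt x) '' (st G (level X n) : Set (TreeAut X)) = G

/-- Every finitely generated `H ≤ G` satisfies `⋂ n, H st_G(n) = H`. -/
def HasWellApproximatedSubgroups (G : Subgroup (TreeAut X)) : Prop :=
  ∀ H : Subgroup (TreeAut X), H ≤ G → H.FG →
    ⋂ n : ℕ, (H : Set (TreeAut X)) * (st G (level X n) : Set (TreeAut X)) = H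

/-! ### Leaf sets, infra-direct products, the Grigorchuk–Nagnibeda alternative -/

/-- A finite set of words none of which is a prefix of another one. -/
def IsLeafSet (Y : Finset (List X)) : Prop :=
  ∀ x ∈ Y, ∀ y ∈ Y, x ≠ y → ¬ x <+: y

/-- A leaf set such that every sufficiently long word has a prefix in it. -/
def IsSpanningLeafSet (Y : Finset (List X)) : Prop :=
  IsLeafSet Y ∧ ∃ N : ℕ, ∀ x : List X, N ≤ x.length → ∃ y ∈ Y, y <+: x

/-- The map `ψ_Y`, sending `g` to `(g_y)_{y ∈ Y}`, on the pointwise stabilizer of `Y` in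
`Aut(X^*)`, where it is a homomorphism. -/
def sectionHom (Y : Finset (List X)) :
    st (⊤ : Subgroup (TreeAut X)) (Y : Set (List X)) →* (Y → TreeAut X) where
  toFun g y := g.1.sectionAt y.1
  map_one' := by
    funext y
    exact sectionAt_one y.1
  map_mul' g h := by
    funext y
    change (g.1 * h.1).sectionAt y.1 = g.1.sectionAt y.1 * h.1.sectionAt y.1
    rw [sectionAt_mul, h.2.2 y.1 y.2]

/-- `st_H(Y)` regarded, through `ψ_Y`, as a subgroup of the product of copies of `Aut(X^*)`
indexed by `Y`. -/
def stProduct (H : Subgroup (TreeAut X)) (Y : Finset (List X)) : Subgroup (Y → TreeAut X) :=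
  ((st H (Y : Set (List X))).subgroupOf (st ⊤ (Y : Set (List X)))).map (sectionHom Y)

end TreeAut

/-- `P` is an infra-direct product of `G^Y`: it is contained in `G^Y` and each of its coordinate
projections has finite index in `G`. -/
def IsInfraDirectProduct {A Y : Type*} [Group A] (G : Subgroup A) (P : Subgroup (Y → A)) : Prop :=
  P ≤ Subgroup.pi Set.univ (fun _ => G) ∧
    ∀ y : Y, (P.map (Pi.evalMonoidHom (fun _ : Y => A) y)).IsFiniteRelIndex G

/-- For every finitely generated `H ≤ G`, either some set of sections `ψ_y(H)` is finite, or
`st_H(Y)` is an infra-direct product of `G^Y` for some spanning leaf set `Y`. -/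
def TreeAut.GrigorchukNagnibedaAlternative {X : Type*} (G : Subgroup (TreeAut X)) : Prop :=
  ∀ H : Subgroup (TreeAut X), H ≤ G → H.FG →
    (∃ y : List X, ((fun h : TreeAut X => h.sectionAt y) '' (H : Set (TreeAut X))).Finite) ∨
    ∃ Y : Finset (List X), TreeAut.IsSpanningLeafSet Y ∧
      IsInfraDirectProduct G (TreeAut.stProduct H Y)

/-- An infinite group all of whose proper quotients are finite. -/
def IsJustInfinite (G : Type*) [Group G] : Prop :=
  Infinite G ∧ ∀ N : Subgroup G, N.Normal → N ≠ ⊥ → Finite (G ⧸ N)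

/-! ### The Chabauty space and the Cantor–Bendixson rank -/

/-- `Sub(G)`, the set of subgroups of the (discrete) group `G`. -/
def ChabautySpace (G : Type*) [Group G] : Type _ := Subgroup G

open Classical in
/-- The indicator function of a subgroup, a point of `{0,1}^G`. -/
noncomputable def ChabautySpace.indicator {G : Type*} [Group G] (H : ChabautySpace G) : G → Bool :=
  fun g => decide (g ∈ (show Subgroup G from H))

/-- The topology of `Sub(G)` as a subspace of `{0,1}^G` with the product topology. -/
noncomputable instance ChabautySpace.instTopologicalSpace {G : Type*} [Group G] :
    TopologicalSpace (ChabautySpace G) :=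
  TopologicalSpace.induced ChabautySpace.indicator inferInstance

/-- The Cantor–Bendixson rank of a space: the least ordinal at which the transfinite sequence of
Cantor–Bendixson derivatives of the space becomes stationary. -/
noncomputable def cantorBendixsonRank.{u} (S : Type u) [TopologicalSpace S] : Ordinal.{u} :=
  sInf {a : Ordinal.{u} |
    CantorBendixson.iteratedDerivedSet (Set.univ : Set S) a =
      CantorBendixson.iteratedDerivedSet (Set.univ : Set S) (a + 1)}

/-! Call K ≤ G large if, at some level, all section groups ψ_x(st_K(x)) have finite index in G
(`HasLargeSections`). The non-large subgroups form the perfect kernel, while the large ones have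
finite but unbounded rank; this forces rank ω (`cantorBendixsonRank_eq_omega0`).

Non-large subgroups are limits of other non-large ones (`preperfect_not_hasLargeSections`). One that
is not finitely generated is a limit of its finitely generated subgroups. If H is finitely
generated, the alternative gives a vertex with finitely many sections, hence arbitrarily deep
vertices z with trivial section group. Adding rist_G(za) to H leaves the section group at zb
trivial, and for deep z well-approximation hides the enlargement from any given finite subset of G.

Large subgroups have finite rank. Let H be finitely generated and large. Some normal subgroup U of
finite index in G lies in all sections of st_H(m). For K ≥ H it normalizes the section groups of
`partialStab K S`, the filtration of st_K(m) obtained by killing coordinates. By a commutator trick,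
a group normalized by U contains commutators of rigid stabilizers wherever it acts non-trivially, so
its active vertices at a fixed level bound its index in overgroups with no further active vertices.
Hence a datum in a finite set, `activitySet`, controls K up to bounded index in overgroups. Since
large groups also have finite index in their normalizers, a finitely generated K ≥ H has finitely
many overgroups of the same activity. It follows that every K ≥ H is finitely generated and that
near K there are, besides K, only overgroups of strictly larger activity. Induction on the number of
inactive entries bounds the rank.

Ranks are unbounded: the elements of st_G(n) whose sections at level n all coincide form a large
subgroup, and each equality of sections can be relaxed separately to equality up to a finite depth,
giving one limit step per vertex (`agreeing`). -/

/-! ### Generalities on indices -/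

namespace Subgroup

/-- The index of `H` in `K` is controlled by the images and the kernels under a homomorphism. -/
theorem relIndex_le_map_mul_inf_ker {A B : Type*} [Group A] [Group B] (f : A →* B)
    {H K : Subgroup A} (hHK : H ≤ K) (h₁ : (H.map f).relIndex (K.map f) ≠ 0)
    (h₂ : (H ⊓ f.ker).relIndex (K ⊓ f.ker) ≠ 0) :
    H.relIndex K ≠ 0 ∧ H.relIndex K ≤
      (H.map f).relIndex (K.map f) * (H ⊓ f.ker).relIndex (K ⊓ f.ker) := by
  have hlift : ∀ q : K.map f ⧸ (H.map f).subgroupOf (K.map f), ∃ k : K,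
      (QuotientGroup.mk (⟨f k, mem_map_of_mem f k.2⟩ : K.map f) :
        K.map f ⧸ (H.map f).subgroupOf (K.map f)) = q := by
    intro q
    obtain ⟨⟨b, k, hk, rfl⟩, rfl⟩ := QuotientGroup.mk_surjective q
    exact ⟨⟨k, hk⟩, rfl⟩
  choose r hr using hlift
  -- Lifted coset representatives of the image, times representatives of the kernel part, meet every
  -- coset of `H` in `K`.
  let s : (K.map f ⧸ (H.map f).subgroupOf (K.map f)) ×
      ((K ⊓ f.ker : Subgroup A) ⧸ (H ⊓ f.ker).subgroupOf (K ⊓ f.ker)) → K ⧸ H.subgroupOf K :=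
    fun p => QuotientGroup.mk (r p.1 * inclusion inf_le_left p.2.out)
  have hs : Function.Surjective s := by
    intro q
    obtain ⟨k, rfl⟩ := QuotientGroup.mk_surjective q
    have h := hr (QuotientGroup.mk ⟨f k, mem_map_of_mem f k.2⟩)
    rw [QuotientGroup.eq, mem_subgroupOf] at h
    obtain ⟨a, ha, hfa⟩ := h
    set q₁ : K.map f ⧸ (H.map f).subgroupOf (K.map f) :=
      QuotientGroup.mk ⟨f k, mem_map_of_mem f k.2⟩ with hq₁
    simp only [coe_mul, coe_inv, ← map_inv, ← map_mul] at hfa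
    have hz : ((r q₁ : K) : A)⁻¹ * k * a⁻¹ ∈ K ⊓ f.ker := by
      refine ⟨K.mul_mem (K.mul_mem (K.inv_mem (r q₁).2) k.2) (K.inv_mem (hHK ha)), ?_⟩
      change _ ∈ f.ker
      rw [MonoidHom.mem_ker, map_mul, map_inv f a, hfa, mul_inv_cancel]
    obtain ⟨z, hzk⟩ : ∃ z : A, z = ((r q₁ : K) : A)⁻¹ * k * a⁻¹ := ⟨_, rfl⟩
    rw [← hzk] at hz
    refine ⟨⟨q₁, QuotientGroup.mk ⟨z, hz⟩⟩, ?_⟩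
    have h' := QuotientGroup.out_eq' (QuotientGroup.mk ⟨z, hz⟩ :
      (K ⊓ f.ker : Subgroup A) ⧸ (H ⊓ f.ker).subgroupOf (K ⊓ f.ker))
    rw [QuotientGroup.eq, mem_subgroupOf] at h'
    change (QuotientGroup.mk (r q₁ * inclusion inf_le_left
      (Quotient.out (QuotientGroup.mk (⟨z, hz⟩ : (K ⊓ f.ker : Subgroup A))))) :
        K ⧸ H.subgroupOf K) = _
    rw [QuotientGroup.eq, mem_subgroupOf]
    have hk : (k : A) = r q₁ * z * a := by rw [hzk]; group
    convert H.mul_mem h'.1 ha using 1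
    simp only [coe_mul, coe_inv, coe_inclusion, mul_inv_rev, hk]
    group
  have : Finite (K.map f ⧸ (H.map f).subgroupOf (K.map f)) := 
    @finite_quotient_of_finiteIndex _ _ _ ⟨h₁⟩
  have : Finite ((K ⊓ f.ker : Subgroup A) ⧸ (H ⊓ f.ker).subgroupOf (K ⊓ f.ker)) :=
    @finite_quotient_of_finiteIndex _ _ _ ⟨h₂⟩
  have : Finite (K ⧸ H.subgroupOf K) := Finite.of_surjective s hs
  refine ⟨Nat.card_pos.ne', ?_⟩
  have := Nat.card_le_card_of_surjective s hs
  rwa [Nat.card_prod] at this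

theorem relIndex_map_ne_zero {A B : Type*} [Group A] [Group B] (f : A →* B)
    {H K : Subgroup A} (h : H.relIndex K ≠ 0) : (H.map f).relIndex (K.map f) ≠ 0 := by
  rw [← relIndex_comap]
  intro h0
  exact h (relIndex_eq_zero_of_le_left (le_comap_map f H) h0)

theorem relIndex_ne_zero_of_le {A : Type*} [Group A] {H K L : Subgroup A} (hHK : H ≤ K)
    (h : H.relIndex L ≠ 0) : K.relIndex L ≠ 0 :=
  fun h0 => h (relIndex_eq_zero_of_le_left hHK h0)

theorem relIndex_ne_zero_of_le_right {A : Type*} [Group A] {H K L : Subgroup A} (hKL : K ≤ L)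
    (h : H.relIndex L ≠ 0) : H.relIndex K ≠ 0 :=
  fun h0 => h (relIndex_eq_zero_of_le_right hKL h0)

/-- A finitely generated subgroup of an image lifts. -/
theorem FG.exists_le_map_eq {A B : Type*} [Group A] [Group B] (f : A →* B) {H : Subgroup A}
    (h : (H.map f).FG) : ∃ L ≤ H, L.FG ∧ L.map f = H.map f := by
  classical
  obtain ⟨s, hs⟩ := h
  have hsub : (s : Set B) ⊆ f '' (H : Set A) := by
    rw [← coe_map, ← hs]
    exact subset_closure
  obtain ⟨t, htH, rfl⟩ := Finset.subset_set_image_iff.1 hsub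
  refine ⟨closure (t : Set A), (closure_le H).2 htH, ⟨t, rfl⟩, ?_⟩
  rw [MonoidHom.map_closure, ← hs, Finset.coe_image]

theorem FG.map_monoidHom {A B : Type*} [Group A] [Group B] (f : A →* B) {H : Subgroup A}
    (h : H.FG) : (H.map f).FG := by
  classical
  obtain ⟨s, rfl⟩ := h
  exact ⟨s.image f, by rw [MonoidHom.map_closure, Finset.coe_image]⟩

theorem FG.of_map_of_injective {A B : Type*} [Group A] [Group B] {f : A →* B}
    (hf : Function.Injective f) {H : Subgroup A} (h : (H.map f).FG) : H.FG := by
  obtain ⟨L, -, hL, e⟩ := FG.exists_le_map_eq f h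
  rwa [← map_injective hf e]

theorem FG.of_relIndex_ne_zero {A : Type*} [Group A] {H K : Subgroup A} (hK : K.FG)
    (hHK : H ≤ K) (h : H.relIndex K ≠ 0) : H.FG := by
  have : Group.FG K := (Group.fg_iff_subgroup_fg K).2 hK
  have : (H.subgroupOf K).FiniteIndex := ⟨h⟩
  have h1 : (H.subgroupOf K).FG := (Group.fg_iff_subgroup_fg _).1 inferInstance
  have h2 := FG.map_monoidHom K.subtype h1
  rwa [subgroupOf_map_subtype, inf_eq_left.2 hHK] at h2

/-- A finitely generated group has finitely many homomorphisms to a finite group. -/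
theorem _root_.Group.FG.finite_monoidHom {A B : Type*} [Group A] [Group B] [hA : Group.FG A]
    [Finite B] : Finite (A →* B) := by
  obtain ⟨s, hs⟩ := hA.out
  refine Finite.of_injective (fun f : A →* B => fun x : s => f x) ?_
  intro f g hfg
  exact MonoidHom.eq_of_eqOn_dense hs fun x hx => congrFun hfg ⟨x, hx⟩

end Subgroup

/-! ### Words, sections and fixed subtrees -/

namespace TreeAut

variable {X : Type*}

theorem prefix_apply_iff (g : TreeAut X) {u v : List X} : g u <+: g v ↔ u <+: v :=
  g.map_rel_iff

/-- The strict chain of prefixes of `w` is sent to a strict chain of prefixes of `g w`. -/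
theorem length_le_length_apply (g : TreeAut X) (w : List X) : w.length ≤ (g w).length := by
  induction w using List.reverseRecOn with
  | nil => simp
  | append_singleton u x ih =>
    have h1 : g u <+: g (u ++ [x]) := g.prefix_apply_iff.2 (List.prefix_append _ _)
    have h2 : (g u).length ≠ (g (u ++ [x])).length := by
      intro h
      have := g.injective (h1.eq_of_length h)
      simp at this
    have := h1.length_le
    simp only [List.length_append, List.length_singleton]
    omega

@[simp]
theorem length_apply (g : TreeAut X) (w : List X) : (g w).length = w.length := by
  refine le_antisymm ?_ (g.length_le_length_apply w)
  have := (g⁻¹).length_le_length_apply (g w)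
  rwa [RelIso.inv_apply_self] at this

theorem inv_apply_eq {g : TreeAut X} {u v : List X} : g⁻¹ u = v ↔ u = g v := by
  constructor
  · rintro rfl
    exact (g.apply_inv_self u).symm
  · rintro rfl
    exact g.inv_apply_self v

theorem inv_apply_of_apply {g : TreeAut X} {v : List X} (h : g v = v) : g⁻¹ v = v :=
  inv_apply_eq.2 h.symm

theorem apply_of_prefix {g : TreeAut X} {u v : List X} (h : u <+: v) (hv : g v = v) : g u = u := by
  have h1 : g u <+: v := by
    rw [← hv]
    exact g.prefix_apply_iff.2 h
  exact (List.prefix_of_prefix_length_le h1 h (by simp)).eq_of_length (by simp)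

theorem prefix_apply_of_apply {g : TreeAut X} {u v : List X} (hu : g u = u) :
    u <+: g v ↔ u <+: v := by
  conv_lhs => rw [← hu]
  exact g.prefix_apply_iff

theorem sectionAt_nil (g : TreeAut X) : g.sectionAt [] = g := by
  ext1 w
  have h := g.apply_append [] w
  have h0 : g [] = [] := List.length_eq_zero_iff.1 (by simp)
  rw [h0] at h
  exact h.symm

theorem sectionAt_append (g : TreeAut X) (x w : List X) :
    g.sectionAt (x ++ w) = (g.sectionAt x).sectionAt w := by
  ext1 v
  have h := g.apply_append (x ++ w) v
  rw [List.append_assoc, apply_append, apply_append g x w, apply_append, List.append_assoc] at h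
  exact (List.append_cancel_left (List.append_cancel_left h)).symm

theorem sectionAt_inv {g : TreeAut X} {x : List X} (h : g x = x) :
    (g⁻¹).sectionAt x = (g.sectionAt x)⁻¹ := by
  rw [eq_inv_iff_mul_eq_one]
  conv_lhs => rw [← h]
  rw [h]
  have := sectionAt_mul g⁻¹ g x
  rw [inv_mul_cancel, sectionAt_one, h] at this
  exact this.symm

theorem sectionAt_apply_of_fix {g : TreeAut X} {x : List X} (h : g x = x) (w : List X) :
    g (x ++ w) = x ++ g.sectionAt x w := by
  rw [apply_append, h]

theorem sectionAt_eq_one_iff {g : TreeAut X} {x : List X} (h : g x = x) :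
    g.sectionAt x = 1 ↔ ∀ w, g (x ++ w) = x ++ w := by
  constructor
  · intro h1 w
    rw [sectionAt_apply_of_fix h, h1, RelIso.one_apply]
  · intro h1
    ext1 w
    have := h1 w
    rw [sectionAt_apply_of_fix h] at this
    exact List.append_cancel_left this

theorem sectionAt_eq_one_of_forall {g : TreeAut X} {x : List X} (h : ∀ w, g (x ++ w) = x ++ w) :
    g.sectionAt x = 1 := by
  have hx : g x = x := by simpa using h []
  exact (sectionAt_eq_one_iff hx).2 h

theorem exists_apply_ne {g : TreeAut X} (h : g ≠ 1) : ∃ w, g w ≠ w := by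
  by_contra! h1
  exact h (by ext1 w; exact h1 w)

theorem commute_of_disjoint {r s : TreeAut X} {x : List X}
    (hr : ∀ v, ¬ x <+: v → r v = v) (hrx : r x = x) (hs : ∀ v, x <+: v → s v = v) :
    r * s = s * r := by
  have hsx : s x = x := hs x (List.prefix_refl x)
  ext1 v
  rw [RelIso.mul_apply, RelIso.mul_apply]
  by_cases hv : x <+: v
  · rw [hs v hv, hs (r v) ((prefix_apply_of_apply hrx).2 hv)]
  · rw [hr v hv, hr (s v) (fun h => hv ((prefix_apply_of_apply hsx).1 h))]

/-! ### Stabilizers -/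

theorem mem_st {H : Subgroup (TreeAut X)} {Y : Set (List X)} {g : TreeAut X} :
    g ∈ st H Y ↔ g ∈ H ∧ ∀ y ∈ Y, g y = y := Iff.rfl

theorem st_le (H : Subgroup (TreeAut X)) (Y : Set (List X)) : st H Y ≤ H := fun _ h => h.1

theorem st_eq_inf (H : Subgroup (TreeAut X)) (Y : Set (List X)) : st H Y = H ⊓ st ⊤ Y := by
  ext g
  simp [mem_st, Subgroup.mem_inf]

theorem st_mono {H K : Subgroup (TreeAut X)} (h : H ≤ K) (Y : Set (List X)) : st H Y ≤ st K Y :=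
  fun _ hg => ⟨h hg.1, hg.2⟩

theorem mem_level {n : ℕ} {w : List X} : w ∈ level X n ↔ w.length = n := Iff.rfl

theorem st_level_anti (H : Subgroup (TreeAut X)) {m n : ℕ} (h : m ≤ n) [Nonempty X] :
    st H (level X n) ≤ st H (level X m) := by
  intro g hg
  refine ⟨hg.1, fun w hw => ?_⟩
  obtain ⟨x⟩ := ‹Nonempty X›
  refine apply_of_prefix (List.prefix_append w (List.replicate (n - m) x)) (hg.2 _ ?_)
  rw [mem_level] at hw ⊢
  simp only [List.length_append, List.length_replicate]
  omega

theorem apply_of_mem_st_level {H : Subgroup (TreeAut X)} {n : ℕ} {g : TreeAut X}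
    (hg : g ∈ st H (level X n)) [Nonempty X] {w : List X} (hw : w.length ≤ n) : g w = w :=
  (st_level_anti H hw hg).2 w rfl

theorem finite_level [Finite X] (n : ℕ) : (level X n).Finite := List.finite_length_eq X n

instance [Finite X] (n : ℕ) : Finite (level X n) := finite_level n

/-- The action on a level of the tree. -/
def levelHom (X : Type*) (n : ℕ) : TreeAut X →* Equiv.Perm (level X n) where
  toFun g :=
    { toFun := fun w => ⟨g w, (length_apply _ _).trans w.2⟩
      invFun := fun w => ⟨g⁻¹ w, (length_apply _ _).trans w.2⟩
      left_inv := fun w => Subtype.ext (g.inv_apply_self w)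
      right_inv := fun w => Subtype.ext (g.apply_inv_self w) }
  map_one' := rfl
  map_mul' _ _ := rfl

theorem levelHom_ker (n : ℕ) : (levelHom X n).ker = st ⊤ (level X n) := by
  ext g
  rw [MonoidHom.mem_ker, mem_st, Equiv.ext_iff]
  constructor
  · exact fun h => ⟨trivial, fun y hy => congrArg Subtype.val (h ⟨y, hy⟩)⟩
  · exact fun h w => Subtype.ext (h.2 w w.2)

instance (n : ℕ) : (st (⊤ : Subgroup (TreeAut X)) (level X n)).Normal := by
  rw [← levelHom_ker]
  infer_instance

instance [Finite X] (n : ℕ) : (st (⊤ : Subgroup (TreeAut X)) (level X n)).FiniteIndex := by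
  rw [← levelHom_ker]
  infer_instance

theorem relIndex_st_level_ne_zero [Finite X] (K : Subgroup (TreeAut X)) (n : ℕ) :
    (st K (level X n)).relIndex K ≠ 0 := by
  rw [st_eq_inf, Subgroup.inf_relIndex_left]
  exact fun h => Subgroup.FiniteIndex.index_ne_zero (Subgroup.index_eq_zero_of_relIndex_eq_zero h)

theorem relIndex_st_level_le [Finite X] (K : Subgroup (TreeAut X)) (n : ℕ) :
    (st K (level X n)).relIndex K ≤ (st (⊤ : Subgroup (TreeAut X)) (level X n)).index := by
  rw [st_eq_inf, Subgroup.inf_relIndex_left, ← Subgroup.relIndex_top_right]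
  exact Subgroup.relIndex_le_of_le_right le_top (by
    rw [Subgroup.relIndex_top_right]
    exact Subgroup.FiniteIndex.index_ne_zero)

theorem conj_mem_st_level {H K : Subgroup (TreeAut X)} {n : ℕ} {k g : TreeAut X}
    (hg : g ∈ st H (level X n)) (hk : k * g * k⁻¹ ∈ K) : k * g * k⁻¹ ∈ st K (level X n) :=
  ⟨hk, ((inferInstance : (st (⊤ : Subgroup (TreeAut X)) (level X n)).Normal).conj_mem g
    ⟨trivial, hg.2⟩ k).2⟩

/-! ### Sections of a vertex stabilizer -/

/-- Taking sections at `x` is a homomorphism on the stabilizer of `x`. -/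
def vertexHom (x : List X) : st (⊤ : Subgroup (TreeAut X)) {x} →* TreeAut X where
  toFun g := g.1.sectionAt x
  map_one' := sectionAt_one x
  map_mul' g h := by
    rw [Subgroup.coe_mul, sectionAt_mul, h.2.2 x rfl]

/-- The subgroup `ψ_x(st_K(x))`. -/
def sec (K : Subgroup (TreeAut X)) (x : List X) : Subgroup (TreeAut X) :=
  (K.subgroupOf (st ⊤ {x})).map (vertexHom x)

theorem mem_sec {K : Subgroup (TreeAut X)} {x : List X} {a : TreeAut X} :
    a ∈ sec K x ↔ ∃ k ∈ K, k x = x ∧ k.sectionAt x = a := by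
  constructor
  · rintro ⟨k, hk, rfl⟩
    exact ⟨k, hk, k.2.2 x rfl, rfl⟩
  · rintro ⟨k, hk, hkx, rfl⟩
    refine ⟨⟨k, trivial, fun y hy => ?_⟩, hk, rfl⟩
    rw [Set.mem_singleton_iff.1 hy, hkx]

theorem sectionAt_mem_sec {K : Subgroup (TreeAut X)} {x : List X} {k : TreeAut X} (hk : k ∈ K)
    (hx : k x = x) : k.sectionAt x ∈ sec K x := mem_sec.2 ⟨k, hk, hx, rfl⟩

theorem sec_mono {H K : Subgroup (TreeAut X)} (h : H ≤ K) (x : List X) : sec H x ≤ sec K x := by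
  intro a ha
  obtain ⟨k, hk, hx, rfl⟩ := mem_sec.1 ha
  exact sectionAt_mem_sec (h hk) hx

theorem sec_append (K : Subgroup (TreeAut X)) (x w : List X) :
    sec K (x ++ w) = sec (sec K x) w := by
  ext a
  constructor
  · intro ha
    obtain ⟨k, hk, hx, rfl⟩ := mem_sec.1 ha
    have hx' := apply_of_prefix (List.prefix_append x w) hx
    rw [sectionAt_append]
    refine sectionAt_mem_sec (sectionAt_mem_sec hk hx') ?_
    rw [sectionAt_apply_of_fix hx'] at hx
    exact List.append_cancel_left hx
  · intro ha
    obtain ⟨b, hb, hw, rfl⟩ := mem_sec.1 ha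
    obtain ⟨k, hk, hx, rfl⟩ := mem_sec.1 hb
    rw [← sectionAt_append]
    refine sectionAt_mem_sec hk ?_
    rw [sectionAt_apply_of_fix hx, hw]

theorem sec_bot (x : List X) : sec (⊥ : Subgroup (TreeAut X)) x = ⊥ := by
  rw [eq_bot_iff]
  intro a ha
  obtain ⟨k, hk, -, rfl⟩ := mem_sec.1 ha
  rw [Subgroup.mem_bot.1 hk, sectionAt_one]
  exact Subgroup.one_mem _

theorem relIndex_sec_ne_zero {H K : Subgroup (TreeAut X)} (h : H.relIndex K ≠ 0) (x : List X) :
    (sec H x).relIndex (sec K x) ≠ 0 := by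
  refine Subgroup.relIndex_map_ne_zero _ ?_
  rw [Subgroup.subgroupOf, Subgroup.relIndex_comap, Subgroup.subgroupOf_map_subtype]
  exact Subgroup.relIndex_ne_zero_of_le_right inf_le_left h

theorem sec_le {G K : Subgroup (TreeAut X)} (hG : IsSelfSimilar G) (hK : K ≤ G) (x : List X) :
    sec K x ≤ G := by
  intro a ha
  obtain ⟨k, hk, -, rfl⟩ := mem_sec.1 ha
  exact hG k (hK hk) x

theorem exists_mem_st_sectionAt_eq {G : Subgroup (TreeAut X)} (hG : IsStronglySelfReplicating G)
    {n : ℕ} {x : List X} (hx : x.length = n) {a : TreeAut X} (ha : a ∈ G) :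
    ∃ g ∈ st G (level X n), g.sectionAt x = a := by
  rcases Nat.eq_zero_or_pos n with rfl | hn
  · rw [List.length_eq_zero_iff.1 hx]
    refine ⟨a, ⟨ha, fun w hw => ?_⟩, sectionAt_nil a⟩
    rw [mem_level, List.length_eq_zero_iff] at hw
    rw [hw]
    exact List.length_eq_zero_iff.1 (by simp)
  · have h := hG.2 n hn x hx
    have ha' : a ∈ (G : Set (TreeAut X)) := ha
    rw [← h] at ha'
    exact ha'

theorem sec_self {G : Subgroup (TreeAut X)} (hG : IsStronglySelfReplicating G) (x : List X) :
    sec G x = G := by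
  refine le_antisymm (sec_le hG.1 le_rfl x) fun a ha => ?_
  obtain ⟨g, hg, rfl⟩ := exists_mem_st_sectionAt_eq hG rfl ha (x := x)
  exact sectionAt_mem_sec hg.1 (hg.2 x rfl)

/-- Sections of `G` are all of `G`, so finite index at a vertex passes to every vertex below it. -/
theorem relIndex_sec_append_ne_zero {G K : Subgroup (TreeAut X)}
    (hG : IsStronglySelfReplicating G) {x : List X} (h : (sec K x).relIndex G ≠ 0) (w : List X) :
    (sec K (x ++ w)).relIndex G ≠ 0 := by
  have := relIndex_sec_ne_zero h w
  rwa [sec_self hG, ← sec_append] at this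

/-! ### Rigid stabilizers -/

theorem ristVertex_le (G : Subgroup (TreeAut X)) (x : List X) : ristVertex G x ≤ G := st_le _ _

theorem ristVertex_anti (G : Subgroup (TreeAut X)) {x y : List X} (h : x <+: y) :
    ristVertex G y ≤ ristVertex G x :=
  fun _ hg => ⟨hg.1, fun v hv => hg.2 v fun hyv => hv (h.trans hyv)⟩

theorem apply_of_mem_ristVertex {G : Subgroup (TreeAut X)} {x : List X} {g : TreeAut X}
    (hg : g ∈ ristVertex G x) {v : List X} (hv : v.length ≤ x.length) : g v = v := by
  have hx : g x = x := by
    by_cases h : x <+: g x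
    · exact (h.eq_of_length (by simp)).symm
    -- Here `g x` lies outside the subtree at `x`, so `g` fixes `g x`.
    · exact g.injective (hg.2 _ h)
  by_cases h : x <+: v
  · rwa [← h.eq_of_length_le hv]
  · exact hg.2 v h

theorem ristVertex_le_st_level (G : Subgroup (TreeAut X)) {x : List X} {n : ℕ}
    (h : n ≤ x.length) : ristVertex G x ≤ st G (level X n) :=
  fun _ hg => ⟨hg.1, fun w hw => apply_of_mem_ristVertex hg (by
    rw [mem_level] at hw; omega)⟩

theorem not_prefix_append {x y : List X} (h₁ : ¬ x <+: y) (h₂ : ¬ y <+: x) (w : List X) :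
    ¬ x <+: y ++ w := by
  intro h
  rcases List.prefix_or_prefix_of_prefix h (List.prefix_append y w) with h | h
  · exact h₁ h
  · exact h₂ h

theorem not_prefix_of_length_eq {x y : List X} (h : x.length = y.length) (hxy : x ≠ y) :
    ¬ x <+: y := fun h' => hxy (h'.eq_of_length h)

theorem sectionAt_of_mem_ristVertex {G : Subgroup (TreeAut X)} {x y : List X} {g : TreeAut X}
    (hg : g ∈ ristVertex G x) (h₁ : ¬ x <+: y) (h₂ : ¬ y <+: x) : g.sectionAt y = 1 :=
  sectionAt_eq_one_of_forall fun w => hg.2 _ (not_prefix_append h₁ h₂ w)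

theorem eq_one_of_mem_ristVertex {G : Subgroup (TreeAut X)} {x : List X} {g : TreeAut X}
    (hg : g ∈ ristVertex G x) (h : g.sectionAt x = 1) : g = 1 := by
  ext1 v
  by_cases hv : x <+: v
  · obtain ⟨w, rfl⟩ := hv
    exact (sectionAt_eq_one_iff (apply_of_mem_ristVertex hg le_rfl)).1 h w
  · exact hg.2 v hv

theorem eq_one_of_mem_ristVertex_of_mem {G : Subgroup (TreeAut X)} {x y : List X} {g : TreeAut X}
    (hx : g ∈ ristVertex G x) (hy : g ∈ ristVertex G y) (h₁ : ¬ x <+: y) (h₂ : ¬ y <+: x) :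
    g = 1 :=
  eq_one_of_mem_ristVertex hy (sectionAt_of_mem_ristVertex hx h₁ h₂)

theorem conj_mem_ristVertex {U : Subgroup (TreeAut X)} {x : List X} {k g : TreeAut X}
    (hg : g ∈ ristVertex U x) (hk : k * g * k⁻¹ ∈ U) : k * g * k⁻¹ ∈ ristVertex U (k x) := by
  refine ⟨hk, fun v hv => ?_⟩
  rw [RelIso.mul_apply, RelIso.mul_apply, hg.2, RelIso.apply_inv_self]
  intro h
  apply hv
  rw [← k.prefix_apply_iff, RelIso.apply_inv_self] at h
  exact h

theorem commute_of_mem_ristVertex {U : Subgroup (TreeAut X)} {x : List X} {r s : TreeAut X}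
    (hr : r ∈ ristVertex U x) (hs : ∀ v, x <+: v → s v = v) : r * s = s * r :=
  commute_of_disjoint hr.2 (apply_of_mem_ristVertex hr le_rfl) hs

end TreeAut

namespace TreeAut

variable {X : Type*}

/-! ### Strongly self-replicating just infinite branch groups -/

/-- The group is a just infinite branch group and strongly self-replicating. -/
structure IsReplicatingJustInfiniteBranch (G : Subgroup (TreeAut X)) : Prop where
  branch : IsBranch G
  justInfinite : IsJustInfinite G
  replicating : IsStronglySelfReplicating G

namespace IsReplicatingJustInfiniteBranch

variable {G : Subgroup (TreeAut X)}

theorem relIndex_bot (hG : IsReplicatingJustInfiniteBranch G) :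
    (⊥ : Subgroup (TreeAut X)).relIndex G = 0 := by
  rw [Subgroup.relIndex_bot_left]
  have := hG.justInfinite.1
  exact Nat.card_eq_zero_of_infinite

theorem ne_bot_of_relIndex_ne_zero (hG : IsReplicatingJustInfiniteBranch G)
    {U : Subgroup (TreeAut X)} (hU : U.relIndex G ≠ 0) : U ≠ ⊥ := by
  rintro rfl
  exact hU hG.relIndex_bot

theorem nontrivial (hG : IsReplicatingJustInfiniteBranch G) : Nontrivial X := by
  by_contra h
  rw [not_nontrivial_iff_subsingleton] at h
  refine hG.ne_bot_of_relIndex_ne_zero (U := G) (by simp [Subgroup.relIndex_self]) ?_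
  rw [eq_bot_iff]
  intro g _
  rw [Subgroup.mem_bot]
  ext1 w
  exact List.ext_getElem (by simp) fun _ _ _ => Subsingleton.elim _ _

theorem relIndex_ne_zero_of_normal (hG : IsReplicatingJustInfiniteBranch G)
    {N : Subgroup (TreeAut X)} (hNG : N ≤ G) (hN : N ≠ ⊥)
    (hconj : ∀ g ∈ G, ∀ n ∈ N, g * n * g⁻¹ ∈ N) : N.relIndex G ≠ 0 := by
  have h1 : (N.subgroupOf G).Normal := ⟨fun n hn g => hconj g g.2 n hn⟩
  have h2 : N.subgroupOf G ≠ ⊥ := by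
    intro h
    rw [Subgroup.subgroupOf_eq_bot] at h
    exact hN (disjoint_self.1 (h.mono_right hNG))
  have := hG.justInfinite.2 _ h1 h2
  have h3 : (N.subgroupOf G).FiniteIndex := Subgroup.finiteIndex_of_finite_quotient
  exact h3.index_ne_zero

/-- Level transitivity conjugates the rigid stabilizers of a level into one another. If one were
trivial, so would be the rigid level stabilizer, which has finite index in an infinite group. -/
theorem ristVertex_ne_bot (hG : IsReplicatingJustInfiniteBranch G) (x : List X) :
    ristVertex G x ≠ ⊥ := by
  intro h
  have h1 : ristLevel G x.length = ⊥ := by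
    rw [ristLevel, eq_bot_iff]
    refine iSup₂_le fun y hy => ?_
    intro r hr
    obtain ⟨g, hg, hgy⟩ := hG.branch.1 x.length y hy x rfl
    have := conj_mem_ristVertex hr (G.mul_mem (G.mul_mem hg hr.1) (G.inv_mem hg))
    rw [hgy, h, Subgroup.mem_bot, conj_eq_one_iff] at this
    exact this
  have h2 := (hG.branch.2 x.length).relIndex_ne_zero
  rw [h1] at h2
  exact h2 hG.relIndex_bot

/-- The words `x a^i b` form an infinite antichain below `x`. Non-trivial elements of their rigid
stabilizers fall into finitely many cosets of `U`, and a quotient of two in the same coset is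
non-trivial because the supports are disjoint. -/
theorem exists_ristVertex_ne_one (hG : IsReplicatingJustInfiniteBranch G)
    {U : Subgroup (TreeAut X)} (hU : U.relIndex G ≠ 0) (x : List X) :
    ∃ r ∈ ristVertex U x, r ≠ 1 := by
  obtain ⟨a, b, hab⟩ := hG.nontrivial
  let v : ℕ → List X := fun i => x ++ (List.replicate i a ++ [b])
  have hv : ∀ i j, i < j → ¬ v i <+: v j := by
    intro i j hij h
    have h1 := (List.prefix_append_right_inj x).1 h
    obtain ⟨d, rfl⟩ : ∃ d, j = i + (d + 1) := ⟨j - i - 1, by omega⟩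
    rw [List.replicate_add, List.append_assoc, List.prefix_append_right_inj,
      List.replicate_succ, List.cons_append, List.cons_prefix_cons] at h1
    exact hab h1.1.symm
  have hv' : ∀ i j, i < j → ¬ v j <+: v i := by
    intro i j hij h
    have := h.length_le
    simp only [v, List.length_append, List.length_replicate, List.length_singleton] at this
    omega
  have hr : ∀ i, ∃ r ∈ ristVertex G (v i), r ≠ 1 := fun i =>
    (Subgroup.ne_bot_iff_exists_ne_one.1 (hG.ristVertex_ne_bot (v i))).elim fun r hr =>
      ⟨r, r.2, fun h => hr (Subtype.ext h)⟩
  choose r hr hr1 using hr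
  have : (U.subgroupOf G).FiniteIndex := ⟨hU⟩
  have : Finite (G ⧸ U.subgroupOf G) := Subgroup.finite_quotient_of_finiteIndex
  obtain ⟨i, j, hij, h⟩ := Finite.exists_ne_map_eq_of_infinite
    (fun i => (QuotientGroup.mk (⟨r i, (hr i).1⟩ : G) : G ⧸ U.subgroupOf G))
  have key : ∀ i j, i < j → (r i)⁻¹ * r j ∈ U → ∃ r ∈ ristVertex U x, r ≠ 1 := by
    intro i j hij hU
    refine ⟨(r i)⁻¹ * r j, ⟨hU, ?_⟩, ?_⟩
    · exact (Subgroup.mul_mem _ (Subgroup.inv_mem _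
        (ristVertex_anti G (List.prefix_append x _) (hr i)))
        (ristVertex_anti G (List.prefix_append x _) (hr j))).2
    · intro h
      rw [inv_mul_eq_one] at h
      exact hr1 i (eq_one_of_mem_ristVertex_of_mem (hr i) (h ▸ hr j) (hv i j hij) (hv' i j hij))
  rcases lt_or_gt_of_ne hij with hij | hij
  · rw [QuotientGroup.eq, Subgroup.mem_subgroupOf] at h
    exact key i j hij h
  · rw [eq_comm, QuotientGroup.eq, Subgroup.mem_subgroupOf] at h
    exact key j i hij h

end IsReplicatingJustInfiniteBranch

/-! ### Subgroups with sections of finite index -/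

/-- All the groups `ψ_x(st_K(x))`, for `x` in some level, have finite index in `G`. -/
def HasLargeSections (G K : Subgroup (TreeAut X)) : Prop :=
  ∃ m : ℕ, ∀ x ∈ level X m, (sec K x).relIndex G ≠ 0

theorem HasLargeSections.mono {G H K : Subgroup (TreeAut X)} (h : HasLargeSections G H)
    (hHK : H ≤ K) : HasLargeSections G K := by
  obtain ⟨m, hm⟩ := h
  exact ⟨m, fun x hx => Subgroup.relIndex_ne_zero_of_le (sec_mono hHK x) (hm x hx)⟩

theorem HasLargeSections.of_relIndex {G H K : Subgroup (TreeAut X)}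
    (h : HasLargeSections G K) (hHK : H.relIndex K ≠ 0) : HasLargeSections G H := by
  obtain ⟨m, hm⟩ := h
  exact ⟨m, fun x hx => Subgroup.relIndex_ne_zero_trans (relIndex_sec_ne_zero hHK x) (hm x hx)⟩

/-- Each section group has finite index in the finitely generated `G`, so its finitely many
generators lift to `K`; only finitely many vertices are involved. -/
theorem HasLargeSections.exists_fg {G K : Subgroup (TreeAut X)} [Finite X]
    (hG : IsSelfSimilar G) (hfg : G.FG) (hK : K ≤ G) {m : ℕ}
    (h : ∀ x ∈ level X m, (sec K x).relIndex G ≠ 0) :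
    ∃ H ≤ K, H.FG ∧ ∀ x ∈ level X m, (sec H x).relIndex G ≠ 0 := by
  have h1 : ∀ x : level X m, ∃ H ≤ K, H.FG ∧ sec H x = sec K x := by
    intro x
    have h2 : (sec K x).FG := Subgroup.FG.of_relIndex_ne_zero hfg (sec_le hG hK x) (h x x.2)
    obtain ⟨L, hL, hLfg, hmap⟩ := Subgroup.FG.exists_le_map_eq _ h2
    refine ⟨L.map (Subgroup.subtype _), ?_, Subgroup.FG.map_monoidHom _ hLfg, ?_⟩
    · rw [Subgroup.map_le_iff_le_comap]
      exact hL
    · rw [sec, sec, ← hmap, Subgroup.subgroupOf, Subgroup.comap_map_eq_self_of_injective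
        (Subgroup.subtype_injective _)]
  choose H hHK hHfg hHsec using h1
  refine ⟨⨆ x, H x, iSup_le hHK, Subgroup.FG.iSup _ hHfg, fun x hx => ?_⟩
  refine Subgroup.relIndex_ne_zero_of_le (sec_mono (le_iSup H ⟨x, hx⟩) x) ?_
  rw [hHsec ⟨x, hx⟩]
  exact h x hx

/-- A trivial section group stays trivial further down, where largeness demands finite index in an
infinite group. -/
theorem HasLargeSections.sec_ne_bot {G K : Subgroup (TreeAut X)}
    (hG : IsReplicatingJustInfiniteBranch G) (h : HasLargeSections G K) (z : List X) :
    sec K z ≠ ⊥ := by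
  intro hz
  obtain ⟨m, hm⟩ := h
  obtain ⟨a, -⟩ := hG.nontrivial
  set w := List.replicate m a
  have h1 : sec K (z ++ w) = ⊥ := by rw [sec_append, hz, sec_bot]
  have h2 : m ≤ (z ++ w).length := by simp [w]
  have h3 := relIndex_sec_append_ne_zero hG.replicating
    (hm ((z ++ w).take m) (List.length_take_of_le h2)) ((z ++ w).drop m)
  rw [List.take_append_drop, h1] at h3
  exact h3 hG.relIndex_bot

theorem hasLargeSections_of_isInfraDirectProduct {G H : Subgroup (TreeAut X)}
    (hG : IsStronglySelfReplicating G) {Y : Finset (List X)} (hY : IsSpanningLeafSet Y)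
    (h : IsInfraDirectProduct G (stProduct H Y)) : HasLargeSections G H := by
  obtain ⟨-, N, hN⟩ := hY
  refine ⟨N, fun x hx => ?_⟩
  obtain ⟨y, hy, w, rfl⟩ := hN x hx.ge
  refine relIndex_sec_append_ne_zero hG ?_ w
  refine Subgroup.relIndex_ne_zero_of_le ?_ (h.2 ⟨y, hy⟩).relIndex_ne_zero
  rintro _ ⟨_, ⟨g, hg, rfl⟩, rfl⟩
  exact sectionAt_mem_sec (Subgroup.mem_subgroupOf.1 hg).1 (g.2.2 y hy)

/-! ### Subgroups with a trivial section are accumulation points -/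

/-- Take a deep word whose stabilizer in `A` is as small as possible: whatever fixes it must then
fix all its extensions. -/
theorem exists_sec_eq_bot [Nonempty X] {A : Subgroup (TreeAut X)}
    (hA : (A : Set (TreeAut X)).Finite) (M : ℕ) : ∃ w : List X, M ≤ w.length ∧ sec A w = ⊥ := by
  obtain ⟨x⟩ := ‹Nonempty X›
  let S : List X → Set (TreeAut X) := fun w => {a | a ∈ A ∧ a w = w}
  have hS : ∀ w, (S w).Finite := fun w => hA.subset fun a ha => ha.1
  obtain ⟨w, hw, hmin⟩ := WellFounded.has_min (measure fun w : List X => (S w).ncard).wf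
    {w | M ≤ w.length} ⟨List.replicate M x, by simp⟩
  refine ⟨w, hw, ?_⟩
  rw [eq_bot_iff]
  intro a ha
  obtain ⟨k, hk, hkw, rfl⟩ := mem_sec.1 ha
  rw [Subgroup.mem_bot, sectionAt_eq_one_iff hkw]
  intro v
  have hsub : S (w ++ v) ⊆ S w := fun a ha =>
    ⟨ha.1, apply_of_prefix (List.prefix_append w v) ha.2⟩
  have heq : S (w ++ v) = S w := by
    refine Set.eq_of_subset_of_ncard_le hsub ?_ (hS w)
    have := hmin (w ++ v) (by
      have : M ≤ w.length := hw
      change M ≤ (w ++ v).length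
      rw [List.length_append]
      omega)
    exact not_lt.1 this
  have hk' : k ∈ S w := ⟨hk, hkw⟩
  rw [← heq] at hk'
  exact hk'.2

/-- The new group is generated by `H` and the rigid stabilizer of a child `z a`. Elements of `H`
fixing `z` act trivially below it, so no translate by `H` of the subtree at another child `z b`
meets the subtree at `z a`. The rigid stabilizer fixes all these translates, and the section group
at `z b` stays trivial. -/
theorem exists_near_of_sec_eq_bot {G H : Subgroup (TreeAut X)}
    (hG : IsReplicatingJustInfiniteBranch G) (hH : H ≤ G) {z : List X} (hz : sec H z = ⊥) :
    ∃ K ≤ G, H ≤ K ∧ K ≠ H ∧ ¬ HasLargeSections G K ∧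
      (K : Set (TreeAut X)) ⊆ (H : Set (TreeAut X)) * (st G (level X z.length) : Set _) := by
  obtain ⟨a, b, hab⟩ := hG.nontrivial
  set R := ristVertex G (z ++ [a]) with hR
  have hRst : R ≤ st G (level X z.length) := ristVertex_le_st_level G (by simp)
  have hfix : ∀ h ∈ H, h z = z → ∀ w, h (z ++ w) = z ++ w := by
    intro h hh hhz
    have := sectionAt_mem_sec hh hhz
    rwa [hz, Subgroup.mem_bot, sectionAt_eq_one_iff hhz] at this
  refine ⟨H ⊔ R, sup_le hH (ristVertex_le G _), le_sup_left, ?_, ?_, ?_⟩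
  · intro h
    have hRH : R ≤ H := h ▸ le_sup_right
    refine hG.ristVertex_ne_bot (z ++ [a]) ((eq_bot_iff).2 fun r hr => ?_)
    have hrz : r z = z := apply_of_mem_ristVertex hr (by simp)
    refine Subgroup.mem_bot.2
      (eq_one_of_mem_ristVertex (ristVertex_anti G (List.prefix_append z [a]) hr) ?_)
    rw [sectionAt_eq_one_iff hrz]
    exact hfix r (hRH hr) hrz
  · have hne : ¬ z ++ [a] <+: z ++ [b] := fun h => by
      rw [List.prefix_append_right_inj] at h
      exact hab (by simpa using h)
    have hne' : ∀ h ∈ H, ∀ w, ¬ z ++ [a] <+: h (z ++ [b] ++ w) := by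
      intro h hh w hp
      have h1 : h z <+: h (z ++ [b] ++ w) := h.prefix_apply_iff.2 (by simp)
      have h2 : z <+: h (z ++ [b] ++ w) := (List.prefix_append z [a]).trans hp
      have hhz : h z = z := (List.prefix_of_prefix_length_le h1 h2 (by simp)).eq_of_length (by simp)
      rw [List.append_assoc, hfix h hh hhz, ← List.append_assoc] at hp
      exact hne (List.prefix_of_prefix_length_le hp (List.prefix_append _ w) (by simp))
    have step : ∀ k ∈ (H : Set (TreeAut X)) ∪ R, ∀ g, (∃ h ∈ H, ∀ w, g (z ++ [b] ++ w) =
        h (z ++ [b] ++ w)) → ∃ h ∈ H, ∀ w, (k * g) (z ++ [b] ++ w) = h (z ++ [b] ++ w) := by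
      rintro k hk g ⟨h, hh, e⟩
      rcases hk with hk | hk
      · exact ⟨k * h, H.mul_mem hk hh, fun w => by rw [RelIso.mul_apply, e, RelIso.mul_apply]⟩
      · refine ⟨h, hh, fun w => ?_⟩
        rw [RelIso.mul_apply, e]
        exact hk.2 _ (hne' h hh w)
    have key : ∀ g ∈ H ⊔ R, ∃ h ∈ H, ∀ w, g (z ++ [b] ++ w) = h (z ++ [b] ++ w) := by
      intro g hg
      rw [Subgroup.sup_eq_closure] at hg
      induction hg using Subgroup.closure_induction_left with
      | one => exact ⟨1, H.one_mem, fun _ => rfl⟩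
      | mul_left k hk g _ ih => exact step k hk g ih
      | inv_mul_cancel k hk g _ ih => exact step k⁻¹ (hk.imp H.inv_mem R.inv_mem) g ih
    intro hL
    refine hL.sec_ne_bot hG (z ++ [b]) ((eq_bot_iff).2 fun c hc => ?_)
    obtain ⟨g, hg, hgx, rfl⟩ := mem_sec.1 hc
    obtain ⟨h, hh, e⟩ := key g hg
    have hhx : h (z ++ [b]) = z ++ [b] := by
      have := e []
      rw [List.append_nil, hgx] at this
      exact this.symm
    rw [Subgroup.mem_bot, sectionAt_eq_one_iff hgx]
    intro w
    rw [e, List.append_assoc]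
    exact hfix h hh (apply_of_prefix (List.prefix_append z [b]) hhx) _
  · intro g hg
    have h1 : g ∈ ((H ⊔ st ⊤ (level X z.length) : Subgroup (TreeAut X)) : Set (TreeAut X)) :=
      sup_le_sup_left (hRst.trans (st_mono le_top _)) H hg
    rw [Subgroup.mul_normal] at h1
    obtain ⟨h, hh, n, hn, rfl⟩ := h1
    refine ⟨h, hh, n, ⟨?_, hn.2⟩, rfl⟩
    exact (Subgroup.mul_mem_cancel_left G (hH hh)).1 (sup_le hH (ristVertex_le G _) hg)

end TreeAut

/-! ### Derived sets in the space of subgroups -/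

namespace ChabautySpace

variable {G : Type*} [Group G]

theorem mem_nhds_iff {H : ChabautySpace G} {U : Set (ChabautySpace G)} :
    U ∈ nhds H ↔ ∃ F : Set G, F.Finite ∧ ∀ K : Subgroup G,
      (∀ g ∈ F, g ∈ K ↔ g ∈ (show Subgroup G from H)) → (show ChabautySpace G from K) ∈ U := by
  classical
  rw [nhds_induced, Filter.mem_comap]
  constructor
  · rintro ⟨V, hV, hVU⟩
    rw [nhds_pi, Filter.mem_pi] at hV
    obtain ⟨F, hF, t, ht, htV⟩ := hV
    refine ⟨F, hF, fun K hK => hVU (htV fun g hg => ?_)⟩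
    have : indicator (show ChabautySpace G from K) g = indicator H g :=
      decide_eq_decide.2 (hK g hg)
    rw [this]
    exact mem_of_mem_nhds (ht g)
  · rintro ⟨F, hF, hFU⟩
    refine ⟨F.pi fun g => {indicator H g}, set_pi_mem_nhds hF fun g _ => ?_, fun K hK => ?_⟩
    · exact (isOpen_discrete _).mem_nhds rfl
    · refine hFU K fun g hg => ?_
      exact decide_eq_decide.1 (hK g hg)

theorem mem_derivedSet_iff {H : ChabautySpace G} {A : Set (ChabautySpace G)} :
    H ∈ derivedSet A ↔ ∀ F : Set G, F.Finite → ∃ K : Subgroup G,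
      (show ChabautySpace G from K) ∈ A ∧ K ≠ H ∧
        ∀ g ∈ F, g ∈ K ↔ g ∈ (show Subgroup G from H) := by
  rw [mem_derivedSet, accPt_iff_nhds]
  constructor
  · intro h F hF
    obtain ⟨K, ⟨hK, hKA⟩, hne⟩ := h {K | ∀ g ∈ F, g ∈ (show Subgroup G from K) ↔
      g ∈ (show Subgroup G from H)} (mem_nhds_iff.2 ⟨F, hF, fun K hK => hK⟩)
    exact ⟨K, hKA, hne, hK⟩
  · intro h U hU
    obtain ⟨F, hF, hFU⟩ := mem_nhds_iff.1 hU
    obtain ⟨K, hKA, hne, hK⟩ := h F hF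
    exact ⟨K, ⟨hFU K hK, hKA⟩, hne⟩

/-- Close to a finitely generated subgroup there are only its overgroups. -/
theorem exists_finite_forall_le {H : Subgroup G} (hH : H.FG) :
    ∃ F : Set G, F.Finite ∧ ∀ K : Subgroup G, (∀ g ∈ F, g ∈ K ↔ g ∈ H) → H ≤ K := by
  obtain ⟨s, rfl⟩ := hH
  refine ⟨s, s.finite_toSet, fun K hK => (Subgroup.closure_le K).2 fun g hg => ?_⟩
  exact (hK g hg).2 (Subgroup.subset_closure hg)

/-- A subgroup that is not finitely generated is approximated by its finitely generated
subgroups. -/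
theorem exists_fg_near_of_not_fg {H : Subgroup G} (hH : ¬ H.FG) {F : Set G} (hF : F.Finite) :
    ∃ K ≤ H, K.FG ∧ K ≠ H ∧ ∀ g ∈ F, g ∈ K ↔ g ∈ H := by
  have hfg : (Subgroup.closure (F ∩ H)).FG :=
    ⟨(hF.inter_of_left (H : Set G)).toFinset, by rw [Set.Finite.coe_toFinset]⟩
  have hle : Subgroup.closure (F ∩ H) ≤ H := (Subgroup.closure_le H).2 Set.inter_subset_right
  exact ⟨_, hle, hfg, fun h => hH (h ▸ hfg),
    fun g hg => ⟨fun h => hle h, fun h => Subgroup.subset_closure ⟨hg, h⟩⟩⟩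

end ChabautySpace

/-! ### Detecting Cantor–Bendixson rank ω -/

section CantorBendixson

open CantorBendixson

theorem CantorBendixson.subset_iteratedDerivedSet_of_preperfect {S : Type*} [TopologicalSpace S]
    {P : Set S} (hP : Preperfect P) (a : Ordinal) : P ⊆ iteratedDerivedSet Set.univ a := by
  have h : iteratedDerivedSet P a ⊆ iteratedDerivedSet Set.univ a :=
    iteratedDerivedSet_mono (Set.subset_univ P) a
  rwa [iteratedDerivedSet_constant_iff_preperfect.1 hP a] at h

theorem CantorBendixson.mem_iteratedDerivedSet_succ {S : Type*} [TopologicalSpace S] {n : ℕ}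
    {x : S} : x ∈ iteratedDerivedSet (Set.univ : Set S) ((n + 1 : ℕ) : Ordinal) ↔
      x ∈ derivedSet (iteratedDerivedSet (Set.univ : Set S) (n : Ordinal)) := by
  rw [Nat.cast_add, Nat.cast_one, iteratedDerivedSet_succ,
    (isClosed_iteratedDerivedSet isClosed_univ _).relDerivedSet_eq]

/-- A criterion for the Cantor–Bendixson rank to be `ω`. -/
theorem cantorBendixsonRank_eq_omega0 {S : Type*} [TopologicalSpace S] {P : Set S}
    (hP : Preperfect P)
    (hfin : ∀ x ∉ P, ∃ n : ℕ, x ∉ iteratedDerivedSet (Set.univ : Set S) (n : Ordinal))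
    (hunb : ∀ n : ℕ, ∃ x ∉ P, x ∈ iteratedDerivedSet (Set.univ : Set S) (n : Ordinal)) :
    cantorBendixsonRank S = Ordinal.omega0 := by
  have hω : iteratedDerivedSet (Set.univ : Set S) Ordinal.omega0 = P := by
    refine Set.Subset.antisymm (fun x hx => ?_) (subset_iteratedDerivedSet_of_preperfect hP _)
    by_contra hxP
    obtain ⟨n, hn⟩ := hfin x hxP
    exact hn (iteratedDerivedSet_antitone _ (Ordinal.natCast_lt_omega0 n).le hx)
  have hω1 : iteratedDerivedSet (Set.univ : Set S) (Ordinal.omega0 + 1) = P := by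
    refine Set.Subset.antisymm ?_ (subset_iteratedDerivedSet_of_preperfect hP _)
    rw [← hω]
    exact iteratedDerivedSet_antitone _ (Order.le_succ _)
  refine le_antisymm (csInf_le' (hω.trans hω1.symm)) (le_csInf ⟨_, hω.trans hω1.symm⟩ ?_)
  intro a ha
  by_contra hlt
  obtain ⟨n, rfl⟩ := Ordinal.lt_omega0.1 (not_le.1 hlt)
  obtain ⟨x, hxP, hx⟩ := hunb n
  -- If the derivatives are stationary at stage `n`, the `n`-th one is the perfect kernel, hence
  -- lies in the `ω`-th one, which is `P`.
  have hker := perfectKernel_eq_iteratedDerivedSet_of_mem_fixedPoints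
    (mem_fixedPoints_of_iteratedDerivedSet_succ_eq (Eq.symm ha))
  rw [← hker] at hx
  exact hxP (hω ▸ perfectKernel_subset_iteratedDerivedSet _ _ hx)

end CantorBendixson

/-! ### The perfect kernel -/

namespace TreeAut

variable {X : Type*} {G : Subgroup (TreeAut X)}

/-- The points of `Sub(G)` without large sections form a preperfect set. -/
theorem preperfect_not_hasLargeSections [Finite X] (hG : IsReplicatingJustInfiniteBranch G)
    (happrox : HasWellApproximatedSubgroups G) (hGN : GrigorchukNagnibedaAlternative G) :
    Preperfect {H : ChabautySpace G |
      ¬ HasLargeSections G ((show Subgroup G from H).map G.subtype)} := by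
  rw [preperfect_iff_subset_derivedSet]
  intro H hH
  rw [ChabautySpace.mem_derivedSet_iff]
  intro F hF
  change Subgroup G at H
  by_cases hfg : H.FG
  · have hle : H.map G.subtype ≤ G := Subgroup.map_subtype_le H
    have hfg' := Subgroup.FG.map_monoidHom G.subtype hfg
    have := hG.nontrivial
    obtain ⟨y, hy⟩ : ∃ y : List X,
        ((fun h : TreeAut X => h.sectionAt y) '' (H.map G.subtype : Set (TreeAut X))).Finite := by
      refine (hGN _ hle hfg').resolve_right ?_
      rintro ⟨Y, hY, hP⟩
      exact hH (hasLargeSections_of_isInfraDirectProduct hG.replicating hY hP)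
    have hsec : (sec (H.map G.subtype) y : Set (TreeAut X)).Finite := by
      refine hy.subset fun a ha => ?_
      obtain ⟨k, hk, -, rfl⟩ := mem_sec.1 ha
      exact ⟨k, hk, rfl⟩
    -- Each `g` outside `H` is separated from `H` at a finite level. A vertex deeper than all levels
    -- needed for `F` keeps the enlarged group away from `F \ H`.
    have hM : ∀ g : G, ∃ M : ℕ, g ∉ H → (g : TreeAut X) ∉
        (H.map G.subtype : Set (TreeAut X)) * (st G (level X M) : Set (TreeAut X)) := by
      intro g
      by_contra! h
      have h1 : (g : TreeAut X) ∈ (H.map G.subtype : Set (TreeAut X)) := by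
        rw [← happrox _ hle hfg']
        exact Set.mem_iInter.2 fun M => (h M).2
      obtain ⟨g', hg', e⟩ := h1
      exact (h 0).1 (Subtype.ext e ▸ hg')
    choose M hM using hM
    obtain ⟨B, hB⟩ := (hF.image M).bddAbove
    obtain ⟨w, hw, hbot⟩ := exists_sec_eq_bot hsec B
    rw [← sec_append] at hbot
    obtain ⟨K, hKG, hHK, hne, hK, hsub⟩ := exists_near_of_sec_eq_bot hG hle hbot
    have hKmap : (K.subgroupOf G).map G.subtype = K := by
      rw [Subgroup.subgroupOf_map_subtype, inf_eq_left.2 hKG]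
    refine ⟨K.subgroupOf G, ?_, ?_, fun g hg => ⟨fun hgK => ?_, fun hgH => ?_⟩⟩
    · change ¬ HasLargeSections G ((K.subgroupOf G).map G.subtype)
      rwa [hKmap]
    · rintro rfl
      exact hne hKmap.symm
    · by_contra hgH
      refine hM g hgH (Set.mul_subset_mul_left (st_level_anti G ?_) (hsub hgK))
      have := hB (Set.mem_image_of_mem M hg)
      rw [List.length_append]
      omega
    · exact hHK ⟨g, hgH, rfl⟩
  · obtain ⟨K, hKH, -, hne, hK⟩ := ChabautySpace.exists_fg_near_of_not_fg hfg hF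
    exact ⟨K, fun h => hH (h.mono (Subgroup.map_mono hKH)), hne, hK⟩

end TreeAut

namespace TreeAut

variable {X : Type*}

theorem sectionAt_mul_of_fix {g h : TreeAut X} {y : List X} (hy : h y = y) :
    (g * h).sectionAt y = g.sectionAt y * h.sectionAt y := by
  rw [sectionAt_mul, hy]

/-! ### Subgroups of arbitrarily large finite rank -/

/-- The elements of `st_G(m)` whose section at `y` agrees with the one at `x₀` on the words of
length at most `j y`. -/
def agreeing (G : Subgroup (TreeAut X)) {m : ℕ} (x₀ : level X m) (j : level X m → ℕ∞) :
    Subgroup (TreeAut X) where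
  carrier := {g | g ∈ st G (level X m) ∧ ∀ y : level X m, ∀ w : List X, (w.length : ℕ∞) ≤ j y →
    g.sectionAt x₀ w = g.sectionAt y w}
  one_mem' := ⟨Subgroup.one_mem _, fun y w _ => by rw [sectionAt_one, sectionAt_one]⟩
  mul_mem' := by
    rintro g h ⟨hg, hg'⟩ ⟨hh, hh'⟩
    refine ⟨Subgroup.mul_mem _ hg hh, fun y w hw => ?_⟩
    rw [sectionAt_mul_of_fix (hh.2 _ x₀.2), sectionAt_mul_of_fix (hh.2 _ y.2), RelIso.mul_apply,
      RelIso.mul_apply, hh' y w hw, hg' y _ (by rwa [length_apply])]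
  inv_mem' := by
    rintro g ⟨hg, hg'⟩
    refine ⟨Subgroup.inv_mem _ hg, fun y w hw => ?_⟩
    rw [sectionAt_inv (hg.2 _ x₀.2), sectionAt_inv (hg.2 _ y.2), inv_apply_eq,
      hg' y _ (by rwa [length_apply]), RelIso.apply_inv_self]

theorem agreeing_le {G : Subgroup (TreeAut X)} {m : ℕ} (x₀ : level X m) (j : level X m → ℕ∞) :
    agreeing G x₀ j ≤ G := fun _ hg => hg.1.1

theorem agreeing_anti {G : Subgroup (TreeAut X)} {m : ℕ} (x₀ : level X m)
    {i j : level X m → ℕ∞} (h : i ≤ j) : agreeing G x₀ j ≤ agreeing G x₀ i :=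
  fun _ hg => ⟨hg.1, fun y w hw => hg.2 y w (hw.trans (h y))⟩

/-- Elements of a rigid stabilizer that agree with the identity up to level `n`. -/
theorem mem_agreeing_of_mem_ristVertex {G : Subgroup (TreeAut X)} {m n : ℕ} {x₀ y : level X m}
    {j : level X m → ℕ∞} (hy : y ≠ x₀) (hj : j y ≤ n) {u : List X} (hu : n ≤ u.length)
    {r : TreeAut X} (hr : r ∈ ristVertex G (y ++ u)) : r ∈ agreeing G x₀ j := by
  have hlen : ∀ v : level X m, (v : List X).length = m := fun v => v.2
  have hm : m ≤ (y ++ u : List X).length := by simp [hlen]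
  have hsec : ∀ v : level X m, v ≠ y → r.sectionAt v = 1 := fun v hv =>
    sectionAt_of_mem_ristVertex (ristVertex_anti G (List.prefix_append _ _) hr)
      (not_prefix_of_length_eq (by simp [hlen]) fun h => hv (Subtype.ext h.symm))
      (not_prefix_of_length_eq (by simp [hlen]) fun h => hv (Subtype.ext h))
  refine ⟨ristVertex_le_st_level G hm hr, fun v w hw => ?_⟩
  rw [hsec x₀ hy.symm]
  by_cases hv : v = y
  · subst hv
    have hwn : w.length ≤ n := by exact_mod_cast hw.trans hj
    have hvfix : r v = v := apply_of_mem_ristVertex hr (by simp)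
    have h := apply_of_mem_ristVertex hr (v := v ++ w) (by simp; omega)
    rw [sectionAt_apply_of_fix hvfix] at h
    exact (List.append_cancel_left h).symm
  · rw [hsec v hv]

open CantorBendixson in
-- Replacing one value `⊤` of `j` by a finite depth `B` gives a strictly larger group with one fewer
-- infinite value. As `B` grows these groups decrease to the original one, so each infinite value
-- contributes one derivative.
theorem agreeing_mem_iteratedDerivedSet [Finite X] {G : Subgroup (TreeAut X)}
    (hG : IsReplicatingJustInfiniteBranch G) {m : ℕ} (x₀ : level X m) (c : ℕ) :
    ∀ j : level X m → ℕ∞, c ≤ {y | y ≠ x₀ ∧ j y = ⊤}.ncard →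
      (show ChabautySpace G from (agreeing G x₀ j).subgroupOf G) ∈
        iteratedDerivedSet (Set.univ : Set (ChabautySpace G)) (c : Ordinal) := by
  classical
  induction c with
  | zero =>
    intro j _
    rw [Nat.cast_zero, iteratedDerivedSet_zero]
    trivial
  | succ c ih =>
    intro j hj
    rw [mem_iteratedDerivedSet_succ, ChabautySpace.mem_derivedSet_iff]
    intro F hF
    obtain ⟨y, hy, hjy⟩ : {y | y ≠ x₀ ∧ j y = ⊤}.Nonempty :=
      Set.nonempty_of_ncard_ne_zero (by omega)
    have hN : ∀ g : G, ∃ N : ℕ, (g : TreeAut X) ∈ agreeing G x₀ (Function.update j y N) →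
        (g : TreeAut X) ∈ agreeing G x₀ j := by
      intro g
      by_contra! h
      refine (h 0).2 ⟨(h 0).1.1, fun v w hw => ?_⟩
      by_cases hv : v = y
      · subst hv
        exact (h w.length).1.2 v w (by rw [Function.update_self])
      · exact (h 0).1.2 v w (by rwa [Function.update_of_ne hv])
    choose N hN using hN
    obtain ⟨B, hB⟩ := (hF.image N).bddAbove
    have hle : Function.update j y B ≤ j := by
      intro v
      by_cases hv : v = y
      · subst hv
        rw [hjy]
        exact le_top
      · rw [Function.update_of_ne hv]
    refine ⟨(agreeing G x₀ (Function.update j y B)).subgroupOf G, ih _ ?_, ?_, fun g hg =>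
      ⟨fun h => ?_, fun h => ?_⟩⟩
    · have hsub : {v | v ≠ x₀ ∧ j v = ⊤} \ {y} ⊆ {v | v ≠ x₀ ∧ Function.update j y B v = ⊤} := by
        rintro v ⟨⟨hv, hjv⟩, hvy⟩
        exact ⟨hv, by rwa [Function.update_of_ne hvy]⟩
      have h1 := Set.ncard_le_ncard hsub (Set.toFinite _)
      rw [Set.ncard_sdiff_singleton_of_mem (show y ∈ {v | v ≠ x₀ ∧ j v = ⊤} from ⟨hy, hjy⟩)] at h1
      omega
    · intro h
      obtain ⟨a, -⟩ := hG.nontrivial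
      -- The rigid stabilizer of a vertex `B` levels below `y` meets the relaxed condition; under
      -- the full one its section at `y` equals the trivial section at `x₀`.
      refine hG.ristVertex_ne_bot (y ++ List.replicate B a) ((eq_bot_iff).2 fun r hr => ?_)
      have hr1 : r ∈ agreeing G x₀ (Function.update j y B) :=
        mem_agreeing_of_mem_ristVertex hy (n := B) (by rw [Function.update_self]) (by simp) hr
      have hr2 : r ∈ agreeing G x₀ j := by
        have h' : (agreeing G x₀ (Function.update j y B)).subgroupOf G =
          (agreeing G x₀ j).subgroupOf G := h
        have hr1' : (⟨r, hr.1⟩ : G) ∈ (agreeing G x₀ (Function.update j y B)).subgroupOf G := hr1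
        rwa [h'] at hr1'
      have hr0 : r.sectionAt x₀ = 1 := sectionAt_of_mem_ristVertex
        (ristVertex_anti G (List.prefix_append _ _) hr)
        (not_prefix_of_length_eq (y.2.trans x₀.2.symm) fun h => hy (Subtype.ext h))
        (not_prefix_of_length_eq (x₀.2.trans y.2.symm) fun h => hy (Subtype.ext h.symm))
      refine Subgroup.mem_bot.2 (eq_one_of_mem_ristVertex
        (ristVertex_anti G (List.prefix_append _ _) hr) ?_)
      ext1 w
      rw [← hr2.2 y w (by rw [hjy]; exact le_top), hr0]
    · refine hN g (agreeing_anti x₀ ?_ h)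
      intro v
      by_cases hv : v = y
      · subst hv
        rw [Function.update_self, Function.update_self]
        exact Nat.cast_le.2 (hB (Set.mem_image_of_mem N hg))
      · rw [Function.update_of_ne hv, Function.update_of_ne hv]
    · exact agreeing_anti x₀ hle h

/-- By self-replication every element of `G` is the section of an element fixing `x`, and
conjugation by the latter preserves the rigid stabilizer of `x`. So this non-trivial section group
is normal in `G`, and just infiniteness applies. -/
theorem relIndex_sec_ristVertex_ne_zero {G : Subgroup (TreeAut X)}
    (hG : IsReplicatingJustInfiniteBranch G) (x : List X) :
    (sec (ristVertex G x) x).relIndex G ≠ 0 := by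
  refine hG.relIndex_ne_zero_of_normal (sec_le hG.replicating.1 (ristVertex_le G x) x) ?_ ?_
  · intro h
    refine hG.ristVertex_ne_bot x ((eq_bot_iff).2 fun r hr => ?_)
    have := sectionAt_mem_sec hr (apply_of_mem_ristVertex hr le_rfl)
    rw [h, Subgroup.mem_bot] at this
    exact Subgroup.mem_bot.2 (eq_one_of_mem_ristVertex hr this)
  · intro g hg n hn
    obtain ⟨r, hr, hrx, rfl⟩ := mem_sec.1 hn
    obtain ⟨k, hk, rfl⟩ := exists_mem_st_sectionAt_eq hG.replicating rfl hg (x := x)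
    have hkx : k x = x := hk.2 x rfl
    have hkx' := inv_apply_of_apply hkx
    rw [← sectionAt_inv hkx, ← sectionAt_mul_of_fix hrx, ← sectionAt_mul_of_fix hkx']
    have := conj_mem_ristVertex hr (G.mul_mem (G.mul_mem hk.1 hr.1) (G.inv_mem hk.1))
    rw [hkx] at this
    exact sectionAt_mem_sec this (apply_of_mem_ristVertex this le_rfl)

/-- Prescribing equal sections on a set of vertices of a level. -/
theorem exists_sectionAt_eq_of_mem [Finite X] {G : Subgroup (TreeAut X)} {m : ℕ} {a : TreeAut X}
    (ha : ∀ x : level X m, a ∈ sec (ristVertex G x) x) :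
    ∃ g ∈ st G (level X m), ∀ x : level X m, g.sectionAt x = a := by
  classical
  have key : ∀ s : Finset (level X m), ∃ g ∈ st G (level X m),
      ∀ x : level X m, (x ∈ s → g.sectionAt x = a) ∧ (x ∉ s → g.sectionAt x = 1) := by
    intro s
    induction s using Finset.induction_on with
    | empty => exact ⟨1, Subgroup.one_mem _, fun x => ⟨by simp, fun _ => sectionAt_one _⟩⟩
    | insert y s hy ih =>
      obtain ⟨g, hg, hgs⟩ := ih
      obtain ⟨r, hr, hry, hra⟩ := mem_sec.1 (ha y)
      refine ⟨g * r, Subgroup.mul_mem _ hg (ristVertex_le_st_level G y.2.ge hr), fun x => ?_⟩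
      have hrx : r x = x := apply_of_mem_ristVertex hr (x.2.trans y.2.symm).le
      rw [sectionAt_mul_of_fix hrx]
      by_cases hxy : x = y
      · subst hxy
        rw [(hgs x).2 hy, hra, one_mul]
        simp
      · have : r.sectionAt x = 1 := sectionAt_of_mem_ristVertex hr
          (not_prefix_of_length_eq (y.2.trans x.2.symm) fun h => hxy (Subtype.ext h.symm))
          (not_prefix_of_length_eq (x.2.trans y.2.symm) fun h => hxy (Subtype.ext h))
        rw [this, mul_one, Finset.mem_insert, or_iff_right hxy]
        exact hgs x
  have := Fintype.ofFinite (level X m)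
  obtain ⟨g, hg, h⟩ := key Finset.univ
  exact ⟨g, hg, fun x => (h x).1 (Finset.mem_univ x)⟩

/-- Diagonal elements, with the same section at all vertices of the level, satisfy every agreement
condition; their sections fill a finite intersection of finite-index subgroups. -/
theorem hasLargeSections_agreeing [Finite X] {G : Subgroup (TreeAut X)}
    (hG : IsReplicatingJustInfiniteBranch G) {m : ℕ} (x₀ : level X m) (j : level X m → ℕ∞) :
    HasLargeSections G (agreeing G x₀ j) := by
  refine ⟨m, fun x hx => ?_⟩
  have h : (⨅ x : level X m, sec (ristVertex G x) x).relIndex G ≠ 0 :=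
    Subgroup.relIndex_iInf_ne_zero fun x => relIndex_sec_ristVertex_ne_zero hG x
  refine Subgroup.relIndex_ne_zero_of_le (fun a ha => ?_) h
  rw [Subgroup.mem_iInf] at ha
  obtain ⟨g, hg, hga⟩ := exists_sectionAt_eq_of_mem ha
  rw [← hga ⟨x, hx⟩]
  refine sectionAt_mem_sec ⟨hg, fun y w _ => ?_⟩ (hg.2 x hx)
  rw [hga, hga]

open CantorBendixson in
theorem exists_hasLargeSections_mem_iteratedDerivedSet [Finite X] {G : Subgroup (TreeAut X)}
    (hG : IsReplicatingJustInfiniteBranch G) (n : ℕ) : ∃ H : ChabautySpace G,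
      HasLargeSections G ((show Subgroup G from H).map G.subtype) ∧
        H ∈ iteratedDerivedSet (Set.univ : Set (ChabautySpace G)) (n : Ordinal) := by
  classical
  obtain ⟨a, b, hab⟩ := hG.nontrivial
  -- The words `b^i a^(n-i)`, told apart by their number of letters `b`, give `n` vertices besides
  -- `x₀`.
  let v : ℕ → List X := fun i => List.replicate i b ++ List.replicate (n - i) a
  have hv : ∀ i ≤ n, v i ∈ level X n := fun i hi => by
    rw [mem_level]
    simp [v, hi]
  have hvc : ∀ i, (v i).count b = i := fun i => by simp [v, List.count_replicate, hab]
  let x₀ : level X n := ⟨v 0, hv 0 (Nat.zero_le n)⟩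
  refine ⟨(agreeing G x₀ fun _ => ⊤).subgroupOf G, ?_,
    agreeing_mem_iteratedDerivedSet hG x₀ n _ ?_⟩
  · change HasLargeSections G (((agreeing G x₀ fun _ => ⊤).subgroupOf G).map G.subtype)
    rw [Subgroup.subgroupOf_map_subtype, inf_eq_left.2 (agreeing_le _ _)]
    exact hasLargeSections_agreeing hG _ _
  · let f : Fin n → level X n := fun i => ⟨v (i + 1), hv _ i.2⟩
    have hf : Function.Injective f := fun i k h => by
      have := congrArg (fun w : level X n => (w : List X).count b) h
      simp only [f, hvc] at this
      exact Fin.ext (by omega)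
    have h1 : Set.range f ⊆ {y | y ≠ x₀ ∧ (⊤ : ℕ∞) = ⊤} := by
      rintro _ ⟨i, rfl⟩
      refine ⟨fun h => ?_, rfl⟩
      have := congrArg (fun w : level X n => (w : List X).count b) h
      simp only [f, x₀, hvc] at this
      omega
    have h2 := Set.ncard_le_ncard h1 (Set.toFinite _)
    rwa [← Set.image_univ, Set.ncard_image_of_injective _ hf, Set.ncard_univ, Nat.card_fin] at h2

end TreeAut

namespace TreeAut

variable {X : Type*}

/-! ### Subgroups normalized by a subgroup of finite index -/

/-- The vertices of level `n` below which `Q` acts non-trivially. -/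
def activeVertices (Q : Subgroup (TreeAut X)) (n : ℕ) : Set (level X n) :=
  {v | ∃ q ∈ Q, ∃ w : List X, q (v ++ w) ≠ v ++ w}

theorem activeVertices_mono {Q Q' : Subgroup (TreeAut X)} (h : Q ≤ Q') (n : ℕ) :
    activeVertices Q n ⊆ activeVertices Q' n :=
  fun _ ⟨q, hq, hw⟩ => ⟨q, h hq, hw⟩

/-- The subgroup generated by the commutators of elements of `rist_U(v s)`, where `v ∈ V` and
`s` has length `d`. -/
def ristCommutator (U : Subgroup (TreeAut X)) {n : ℕ} (V : Set (level X n)) (d : ℕ) :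
    Subgroup (TreeAut X) :=
  Subgroup.closure {c | ∃ v ∈ V, ∃ s : List X, s.length = d ∧ ∃ a ∈ ristVertex U (v ++ s),
    ∃ b ∈ ristVertex U (v ++ s), c = b * a * b⁻¹ * a⁻¹}

/-- The commutator trick for rigid stabilizers. -/
theorem commutator_mem_of_apply_ne {U Q : Subgroup (TreeAut X)}
    (hUQ : ∀ u ∈ U, ∀ q ∈ Q, u * q * u⁻¹ ∈ Q) {q : TreeAut X} (hq : q ∈ Q) {v : List X}
    (hv : q v ≠ v) {a b : TreeAut X} (ha : a ∈ ristVertex U v) (hb : b ∈ ristVertex U v) :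
    b * a * b⁻¹ * a⁻¹ ∈ Q := by
  have hd : q * a⁻¹ * q⁻¹ ∈ ristVertex ⊤ (q v) :=
    conj_mem_ristVertex (U := ⊤) ⟨trivial, (Subgroup.inv_mem _ ha).2⟩ trivial
  have hcomm : b * (q * a⁻¹ * q⁻¹) = q * a⁻¹ * q⁻¹ * b :=
    commute_of_mem_ristVertex hb fun w hw => hd.2 w fun h =>
      hv ((List.prefix_of_prefix_length_le h hw (by simp)).eq_of_length (by simp))
  -- Writing `[x,y]` for `x y x⁻¹ y⁻¹`, one has `[b,[a,q]] = [b,a]`: the factor `q a⁻¹ q⁻¹` of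
  -- `[a,q]` is supported below `q v ≠ v` and commutes with `b`.
  have hc : a * q * a⁻¹ * q⁻¹ ∈ Q := Q.mul_mem (hUQ a ha.1 q hq) (Q.inv_mem hq)
  have hbc := Q.mul_mem (hUQ b hb.1 _ hc) (Q.inv_mem hc)
  have e : b * (a * q * a⁻¹ * q⁻¹) * b⁻¹ * (a * q * a⁻¹ * q⁻¹)⁻¹ = b * a * b⁻¹ * a⁻¹ := by
    calc b * (a * q * a⁻¹ * q⁻¹) * b⁻¹ * (a * q * a⁻¹ * q⁻¹)⁻¹
        = b * a * ((q * a⁻¹ * q⁻¹) * b⁻¹ * (q * a⁻¹ * q⁻¹)⁻¹) * a⁻¹ := by group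
      _ = b * a * b⁻¹ * a⁻¹ := by
        have : (q * a⁻¹ * q⁻¹) * b⁻¹ * (q * a⁻¹ * q⁻¹)⁻¹ = b⁻¹ := by
          rw [mul_inv_eq_iff_eq_mul, eq_inv_mul_iff_mul_eq, ← mul_assoc, hcomm, mul_inv_cancel_right]
        rw [this]
  rwa [e] at hbc

/-- `U` permutes transitively the vertices of any given level below any vertex of level `n`. -/
def IsTransitiveBelow (U : Subgroup (TreeAut X)) (n : ℕ) : Prop :=
  ∀ v : level X n, ∀ s t : List X, s.length = t.length → ∃ u ∈ U, u (v ++ s) = v ++ t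

/-- The sets of cosets of `U` met by the stabilizers of `a^k` decrease with `k`, hence are constant
from some `n` on. An element of `G` taking `v s` to `v t` can then be corrected by one fixing a
longer power of `a` so as to land in `U`. -/
theorem exists_isTransitiveBelow {G U : Subgroup (TreeAut X)}
    (hG : IsReplicatingJustInfiniteBranch G) (hU : U.relIndex G ≠ 0)
    (hconj : ∀ g ∈ G, ∀ u ∈ U, g * u * g⁻¹ ∈ U) : ∃ n, IsTransitiveBelow U n := by
  obtain ⟨a, -⟩ := hG.nontrivial
  have : (U.subgroupOf G).FiniteIndex := ⟨hU⟩
  have : Finite (G ⧸ U.subgroupOf G) := Subgroup.finite_quotient_of_finiteIndex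
  let S : ℕ → Set (G ⧸ U.subgroupOf G) := fun k =>
    {q | ∃ g : G, (g : TreeAut X) (List.replicate k a) = List.replicate k a ∧
      QuotientGroup.mk g = q}
  obtain ⟨n, -, hn⟩ := WellFounded.has_min (measure fun k => (S k).ncard).wf Set.univ ⟨0, trivial⟩
  have hS : ∀ d, S (n + d) = S n := by
    intro d
    refine Set.eq_of_subset_of_ncard_le ?_ (not_lt.1 (hn (n + d) trivial)) (Set.toFinite _)
    rintro _ ⟨g, hg, rfl⟩
    refine ⟨g, apply_of_prefix ?_ hg, rfl⟩
    rw [List.replicate_add]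
    exact List.prefix_append _ _
  refine ⟨n, fun v s t hst => ?_⟩
  have hlv : (v : List X).length = n := v.2
  obtain ⟨g, hg, hgs⟩ := hG.branch.1 (n + s.length) (List.replicate (n + s.length) a)
    (by simp [mem_level]) (v ++ s) (by simp [mem_level, hlv])
  obtain ⟨g', hg', hgt⟩ := hG.branch.1 (n + s.length) (List.replicate (n + s.length) a)
    (by simp [mem_level]) (v ++ t) (by simp [mem_level, hlv, hst])
  have hpre : ∀ k : TreeAut X, ∀ w, k (List.replicate (n + s.length) a) = v ++ w →
      k (List.replicate n a) = v := by
    intro k w hk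
    rw [List.replicate_add, apply_append] at hk
    exact (List.append_inj hk (by simp [hlv])).1
  have h1 : (QuotientGroup.mk (⟨g⁻¹ * g', G.mul_mem (G.inv_mem hg) hg'⟩ : G) :
      G ⧸ U.subgroupOf G) ∈ S n := by
    refine ⟨_, ?_, rfl⟩
    change (g⁻¹ * g') _ = _
    rw [RelIso.mul_apply, hpre g' t hgt, inv_apply_eq, hpre g s hgs]
  rw [← hS s.length] at h1
  obtain ⟨k, hk, e⟩ := h1
  rw [QuotientGroup.eq, Subgroup.mem_subgroupOf] at e
  have hu : (k : TreeAut X)⁻¹ * (g⁻¹ * g') ∈ U := e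
  refine ⟨(g * k) * ((k : TreeAut X)⁻¹ * (g⁻¹ * g')) * (g * k)⁻¹,
    hconj _ (G.mul_mem hg k.2) _ hu, ?_⟩
  have e' : (g * k) * ((k : TreeAut X)⁻¹ * (g⁻¹ * g')) * (g * k)⁻¹ = g' * (g * k)⁻¹ := by group
  have hgk : (g * k)⁻¹ (v ++ s) = List.replicate (n + s.length) a := by
    rw [inv_apply_eq, RelIso.mul_apply, hk, hgs]
  rw [e', RelIso.mul_apply, hgk, hgt]

/-- Below an active vertex `v` some element of `Q` moves a word, hence all its extensions.
Conjugating by `U` moves any chosen `v s` of length `d` below `v`, and the commutator trick applies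
there. -/
theorem exists_ristCommutator_le [Finite X] [Nonempty X] {U Q : Subgroup (TreeAut X)} {n : ℕ}
    (hn : IsTransitiveBelow U n) (hUQ : ∀ u ∈ U, ∀ q ∈ Q, u * q * u⁻¹ ∈ Q) :
    ∃ d, ristCommutator U (activeVertices Q n) d ≤ Q := by
  obtain ⟨x⟩ := ‹Nonempty X›
  have h1 : ∀ v : level X n, ∃ l : ℕ, v ∈ activeVertices Q n →
      ∃ q ∈ Q, ∃ w : List X, w.length = l ∧ q (v ++ w) ≠ v ++ w := by
    intro v
    by_cases hv : v ∈ activeVertices Q n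
    · obtain ⟨q, hq, w, hw⟩ := hv
      exact ⟨w.length, fun _ => ⟨q, hq, w, rfl, hw⟩⟩
    · exact ⟨0, fun h => absurd h hv⟩
  choose l hl using h1
  obtain ⟨d, hd⟩ := (Set.finite_range l).bddAbove
  refine ⟨d, (Subgroup.closure_le Q).2 ?_⟩
  rintro _ ⟨v, hv, s, hs, a, ha, b, hb, rfl⟩
  obtain ⟨q, hq, w, hwl, hw⟩ := hl v hv
  have hld : l v ≤ d := hd ⟨v, rfl⟩
  obtain ⟨u, hu, hus⟩ := hn v (w ++ List.replicate (d - l v) x) s (by simp; omega)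
  refine commutator_mem_of_apply_ne hUQ (hUQ u hu q hq) (fun h => hw ?_) ha hb
  have h2 : u⁻¹ (v ++ s) = v ++ (w ++ List.replicate (d - l v) x) := inv_apply_eq.2 hus.symm
  rw [RelIso.mul_apply, RelIso.mul_apply, h2, ← hus] at h
  have h3 := u.injective h
  rw [← List.append_assoc] at h3
  exact apply_of_prefix (List.prefix_append _ _) h3

theorem fix_of_mem_ristCommutator {U : Subgroup (TreeAut X)} {n d : ℕ} {V : Set (level X n)}
    {c : TreeAut X} (hc : c ∈ ristCommutator U V d) :
    (∀ v : level X n, c v = v) ∧ ∀ v ∉ V, ∀ w, c (v ++ w) = v ++ w := by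
  have h : ristCommutator U V d ≤
      st ⊤ (level X n ∪ {x | ∃ v : level X n, v ∉ V ∧ (v : List X) <+: x}) := by
    refine (Subgroup.closure_le _).2 ?_
    rintro _ ⟨v, hv, s, hs, a, ha, b, hb, rfl⟩
    have h1 : ∀ g ∈ ristVertex U (v ++ s),
        g ∈ st ⊤ (level X n ∪ {x | ∃ v : level X n, v ∉ V ∧ (v : List X) <+: x}) := by
      refine fun g hg => ⟨trivial, ?_⟩
      rintro x (hx | ⟨y, hy, w, rfl⟩)
      · refine apply_of_mem_ristVertex hg ?_
        rw [mem_level] at hx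
        have : (v : List X).length = n := v.2
        simp; omega
      · refine (ristVertex_anti U (List.prefix_append _ _) hg).2 _ ?_
        have hne : (v : List X) ≠ y := fun h => hy (Subtype.ext h ▸ hv)
        exact not_prefix_append (not_prefix_of_length_eq (v.2.trans y.2.symm) hne)
          (not_prefix_of_length_eq (y.2.trans v.2.symm) hne.symm) w
    exact Subgroup.mul_mem _ (Subgroup.mul_mem _ (Subgroup.mul_mem _ (h1 b hb) (h1 a ha))
      (Subgroup.inv_mem _ (h1 b hb))) (Subgroup.inv_mem _ (h1 a ha))
  exact ⟨fun v => (h hc).2 v (Or.inl v.2),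
    fun v hv w => (h hc).2 _ (Or.inr ⟨v, hv, List.prefix_append _ _⟩)⟩

/-- Each generator lives below a single vertex of level `n`. Dropping the generators outside `V`
does not change the action below `V`, and `c` is trivial elsewhere. -/
theorem mem_ristCommutator_of_fix [Nonempty X] {U : Subgroup (TreeAut X)} {n d : ℕ}
    {V : Set (level X n)} {c : TreeAut X} (hc : c ∈ ristCommutator U (Set.univ : Set (level X n)) d)
    (hfix : ∀ v ∉ V, ∀ w, c (v ++ w) = v ++ w) : c ∈ ristCommutator U V d := by
  classical
  have key : ∃ e ∈ ristCommutator U V d, ∀ v ∈ V, ∀ w, c (v ++ w) = e (v ++ w) := by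
    clear hfix
    rw [ristCommutator] at hc
    induction hc using Subgroup.closure_induction with
    | mem c hc =>
      obtain ⟨v, -, hc⟩ := hc
      by_cases hv : v ∈ V
      · exact ⟨c, Subgroup.subset_closure ⟨v, hv, hc⟩, fun _ _ _ => rfl⟩
      · refine ⟨1, Subgroup.one_mem _, fun y hy w => ?_⟩
        have hc' : c ∈ ristCommutator U {v} d := Subgroup.subset_closure ⟨v, rfl, hc⟩
        exact (fix_of_mem_ristCommutator hc').2 y (fun h => hv (h ▸ hy)) w
    | one => exact ⟨1, Subgroup.one_mem _, fun _ _ _ => rfl⟩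
    | mul c₁ c₂ _ _ h₁ h₂ =>
      obtain ⟨e₁, he₁, h₁⟩ := h₁
      obtain ⟨e₂, he₂, h₂⟩ := h₂
      refine ⟨e₁ * e₂, Subgroup.mul_mem _ he₁ he₂, fun v hv w => ?_⟩
      rw [RelIso.mul_apply, RelIso.mul_apply, h₂ v hv,
        sectionAt_apply_of_fix ((fix_of_mem_ristCommutator he₂).1 v), h₁ v hv]
    | inv c _ h =>
      obtain ⟨e, he, h⟩ := h
      refine ⟨e⁻¹, Subgroup.inv_mem _ he, fun v hv w => ?_⟩
      have hv' := inv_apply_of_apply ((fix_of_mem_ristCommutator he).1 v)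
      rw [inv_apply_eq, sectionAt_apply_of_fix hv', h v hv, ← sectionAt_apply_of_fix hv',
        RelIso.apply_inv_self]
  obtain ⟨e, he, h⟩ := key
  have : c = e := by
    have hlong : ∀ v : level X n, ∀ w, c (v ++ w) = e (v ++ w) := by
      intro v w
      by_cases hv : v ∈ V
      · exact h v hv w
      · rw [hfix v hv, (fix_of_mem_ristCommutator he).2 v hv]
    ext1 x
    by_cases hx : n ≤ x.length
    · have := hlong ⟨x.take n, List.length_take_of_le hx⟩ (x.drop n)
      rwa [List.take_append_drop] at this
    · have h1 : ∀ g : TreeAut X, (∀ v : level X n, g v = v) → g x = x := fun g hg =>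
        apply_of_mem_st_level (H := ⊤) (n := n) ⟨trivial, fun y hy => hg ⟨y, hy⟩⟩ (by omega)
      rw [h1 c (fix_of_mem_ristCommutator hc).1, h1 e (fix_of_mem_ristCommutator he).1]
  rwa [this]

theorem exists_commutator_ne_one {G U : Subgroup (TreeAut X)}
    (hG : IsReplicatingJustInfiniteBranch G) (hU : U.relIndex G ≠ 0) (v : List X) :
    ∃ a ∈ ristVertex U v, ∃ b ∈ ristVertex U v, b * a * b⁻¹ * a⁻¹ ≠ 1 := by
  obtain ⟨b, hb, hb1⟩ := hG.exists_ristVertex_ne_one hU v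
  obtain ⟨x, hx⟩ := exists_apply_ne hb1
  have hvx : v <+: x := by
    by_contra h
    exact hx (hb.2 x h)
  obtain ⟨a, ha, ha1⟩ := hG.exists_ristVertex_ne_one hU x
  refine ⟨a, ristVertex_anti U hvx ha, b, hb, fun h => ha1 ?_⟩
  rw [mul_inv_eq_one] at h
  have h1 := conj_mem_ristVertex ha (k := b) (U.mul_mem (U.mul_mem hb.1 ha.1) (U.inv_mem hb.1))
  rw [h] at h1
  exact eq_one_of_mem_ristVertex_of_mem h1 ha (not_prefix_of_length_eq (by simp) hx)
    (not_prefix_of_length_eq (by simp) hx.symm)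

theorem relIndex_ristCommutator_ne_zero {G U : Subgroup (TreeAut X)}
    (hG : IsReplicatingJustInfiniteBranch G) (hU : U.relIndex G ≠ 0) (hUG : U ≤ G)
    (hconj : ∀ g ∈ G, ∀ u ∈ U, g * u * g⁻¹ ∈ U) (n d : ℕ) :
    (ristCommutator U (Set.univ : Set (level X n)) d).relIndex G ≠ 0 := by
  refine hG.relIndex_ne_zero_of_normal ((Subgroup.closure_le _).2 ?_) ?_ ?_
  · rintro _ ⟨v, hv, s, hs, a, ha, b, hb, rfl⟩
    have ha' := hUG ha.1
    have hb' := hUG hb.1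
    exact G.mul_mem (G.mul_mem (G.mul_mem hb' ha') (G.inv_mem hb')) (G.inv_mem ha')
  · obtain ⟨x, -⟩ := hG.nontrivial
    obtain ⟨a, ha, b, hb, h⟩ := exists_commutator_ne_one hG hU
      (List.replicate n x ++ List.replicate d x)
    intro h0
    refine h ((Subgroup.mem_bot).1 (h0 ▸ Subgroup.subset_closure ?_))
    exact ⟨⟨List.replicate n x, by simp [mem_level]⟩, trivial, List.replicate d x, by simp,
      a, ha, b, hb, rfl⟩
  · intro g hg c hc
    rw [ristCommutator] at hc
    induction hc using Subgroup.closure_induction with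
    | mem c hc =>
      obtain ⟨v, hv, s, hs, a, ha, b, hb, rfl⟩ := hc
      refine Subgroup.subset_closure ⟨⟨g v, (length_apply g v).trans v.2⟩, trivial,
        g.sectionAt v s, by simpa using hs, g * a * g⁻¹, ?_, g * b * g⁻¹, ?_, by group⟩
      · rw [← apply_append]
        exact conj_mem_ristVertex ha (hconj g hg a ha.1)
      · rw [← apply_append]
        exact conj_mem_ristVertex hb (hconj g hg b hb.1)
    | one => simp
    | mul c₁ c₂ _ _ h₁ h₂ =>
      rw [show g * (c₁ * c₂) * g⁻¹ = (g * c₁ * g⁻¹) * (g * c₂ * g⁻¹) by group]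
      exact Subgroup.mul_mem _ h₁ h₂
    | inv c _ h =>
      rw [show g * c⁻¹ * g⁻¹ = (g * c * g⁻¹)⁻¹ by group]
      exact Subgroup.inv_mem _ h

/-- The index of a normalized subgroup in an overgroup with the same active vertices. -/
theorem exists_relIndex_le_of_activeVertices_subset [Finite X] {G U Q : Subgroup (TreeAut X)}
    (hG : IsReplicatingJustInfiniteBranch G) (hU : U.relIndex G ≠ 0) (hUG : U ≤ G)
    (hconj : ∀ g ∈ G, ∀ u ∈ U, g * u * g⁻¹ ∈ U) {n : ℕ} (hn : IsTransitiveBelow U n)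
    (hUQ : ∀ u ∈ U, ∀ q ∈ Q, u * q * u⁻¹ ∈ Q) :
    ∃ B : ℕ, ∀ Q' ≤ G, activeVertices Q' n ⊆ activeVertices Q n →
      Q.relIndex Q' ≠ 0 ∧ Q.relIndex Q' ≤ B := by
  have := hG.nontrivial
  obtain ⟨d, hd⟩ := exists_ristCommutator_le hn hUQ
  have hC := relIndex_ristCommutator_ne_zero hG hU hUG hconj n d
  set C := ristCommutator U (Set.univ : Set (level X n)) d with hCdef
  -- An element of `C` in `Q'` acts only below vertices active for `Q`, so it lies in `Q`. The bound
  -- is therefore independent of `Q'`.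
  refine ⟨C.relIndex G, fun Q' hQ' hV => ?_⟩
  have hle : C ⊓ Q' ≤ Q := by
    rintro c ⟨hc, hcQ⟩
    refine hd (mem_ristCommutator_of_fix hc fun v hv w => ?_)
    by_contra hne
    exact hv (hV ⟨c, hcQ, w, hne⟩)
  have h1 : (C ⊓ Q').relIndex Q' ≠ 0 := by
    rw [Subgroup.inf_relIndex_right]
    exact Subgroup.relIndex_ne_zero_of_le_right hQ' hC
  refine ⟨Subgroup.relIndex_ne_zero_of_le hle h1, ?_⟩
  calc Q.relIndex Q' ≤ (C ⊓ Q').relIndex Q' := Subgroup.relIndex_le_of_le_left hle h1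
    _ = C.relIndex Q' := Subgroup.inf_relIndex_right _ _
    _ ≤ C.relIndex G := Subgroup.relIndex_le_of_le_right hQ' hC

/-- If `q` moves `v w`, choose `u` rigid below `v w` with `u x ≠ x`. The conjugate of `u` by `q` is
supported elsewhere and fixes `x`, so the commutator sends `u x` to `x`. -/
theorem activeVertices_subset_of_commutator_mem {G U Q Q' : Subgroup (TreeAut X)}
    (hG : IsReplicatingJustInfiniteBranch G) (hU : U.relIndex G ≠ 0)
    (h : ∀ q ∈ Q', ∀ u ∈ U, q * u * q⁻¹ * u⁻¹ ∈ Q) (n : ℕ) :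
    activeVertices Q' n ⊆ activeVertices Q n := by
  rintro v ⟨q, hq, w, hw⟩
  obtain ⟨u, hu, hu1⟩ := hG.exists_ristVertex_ne_one hU (v ++ w)
  obtain ⟨x, hx⟩ := exists_apply_ne hu1
  have hvx : (v ++ w : List X) <+: x := by
    by_contra h
    exact hx (hu.2 x h)
  have hvux := (prefix_apply_of_apply (apply_of_mem_ristVertex hu le_rfl)).2 hvx
  have hc : q * u * q⁻¹ ∈ ristVertex ⊤ (q (v ++ w)) :=
    conj_mem_ristVertex (U := ⊤) ⟨trivial, hu.2⟩ trivial
  have hcx : (q * u * q⁻¹) x = x := hc.2 x fun hp =>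
    hw ((List.prefix_of_prefix_length_le hp hvx (by simp)).eq_of_length (by simp))
  obtain ⟨t, ht⟩ := hvux
  refine ⟨_, h q hq u hu.1, w ++ t, ?_⟩
  rw [← List.append_assoc, ht, RelIso.mul_apply, RelIso.inv_apply_self, hcx]
  exact hx.symm

end TreeAut

/-! ### Overgroups of bounded index -/

namespace Subgroup

theorem finite_Icc_of_relIndex_ne_zero {A : Type*} [Group A] {H K : Subgroup A}
    (h : H.relIndex K ≠ 0) : (Set.Icc H K).Finite := by
  have : (H.subgroupOf K).FiniteIndex := ⟨h⟩
  have : Finite (K ⧸ H.subgroupOf K) := finite_quotient_of_finiteIndex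
  let S : Subgroup A → Set (K ⧸ H.subgroupOf K) := fun L =>
    {q | ∃ k : K, (k : A) ∈ L ∧ QuotientGroup.mk k = q}
  have key : ∀ L ∈ Set.Icc H K, ∀ L' ∈ Set.Icc H K, S L = S L' → L ≤ L' := by
    intro L hL L' hL' hS k hk
    have h1 : (QuotientGroup.mk (⟨k, hL.2 hk⟩ : K) : K ⧸ H.subgroupOf K) ∈ S L := ⟨_, hk, rfl⟩
    rw [hS] at h1
    obtain ⟨k', hk', e⟩ := h1
    rw [QuotientGroup.eq, mem_subgroupOf] at e
    exact (Subgroup.mul_mem_cancel_left L' (L'.inv_mem hk')).1 (hL'.1 e)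
  exact Set.Finite.of_finite_image (f := S) (Set.toFinite _)
    fun L hL L' hL' hS => le_antisymm (key L hL L' hL' hS) (key L' hL' L hL hS.symm)

/-- If `N` has finite index in its normalizer for every subgroup `N` of finite index of the
finitely generated group `K`, then `K` has finitely many overgroups of bounded index. -/
theorem finite_setOf_relIndex_le {A : Type*} [Group A] {G K : Subgroup A} (hK : K.FG)
    (hnorm : ∀ N ≤ K, N.relIndex K ≠ 0 → N.relIndex (normalizer N ⊓ G) ≠ 0) (B : ℕ) :
    {L : Subgroup A | K ≤ L ∧ L ≤ G ∧ K.relIndex L ≠ 0 ∧ K.relIndex L ≤ B}.Finite := by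
  have : Group.FG K := (Group.fg_iff_subgroup_fg K).2 hK
  have : ∀ c : ℕ, Finite (K →* Equiv.Perm (Fin c)) := fun c => Group.FG.finite_monoidHom
  -- This intersection of finitely many kernels lies in the core of `K` in any overgroup `L` of
  -- index at most `B`, by the action on `L ⧸ K`. Only finitely many cores `N` can occur, and `L`
  -- lies between `N` and its normalizer.
  let N₀ : Subgroup K := ⨅ p : (c : Fin (B + 1)) × (K →* Equiv.Perm (Fin c)), p.2.ker
  have hN₀ : N₀.FiniteIndex := finiteIndex_iInf fun p => inferInstance
  have hN₀K : (N₀.map K.subtype).relIndex K ≠ 0 := by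
    rw [relIndex, subgroupOf, comap_map_eq_self_of_injective K.subtype_injective]
    exact hN₀.index_ne_zero
  refine ((finite_Icc_of_relIndex_ne_zero hN₀K).biUnion (t := fun N => {L | N ∈ Set.Icc
    (N₀.map K.subtype) K ∧ L ∈ Set.Icc N (normalizer N ⊓ G)}) fun N hN => ?_).subset ?_
  · refine (finite_Icc_of_relIndex_ne_zero (hnorm N hN.2
      (relIndex_ne_zero_of_le hN.1 hN₀K))).subset fun L hL => hL.2
  · rintro L ⟨hKL, hLG, hL0, hLB⟩
    let N : Subgroup A := (K.subgroupOf L).normalCore.map L.subtype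
    have hNK : N ≤ K := by
      rintro _ ⟨l, hl, rfl⟩
      exact normalCore_le (K.subgroupOf L) hl
    have hNL : N ≤ L := map_subtype_le _
    have hLN : L ≤ normalizer N := by
      intro l hl
      rw [mem_normalizer_iff]
      have key : ∀ l ∈ L, ∀ n ∈ N, l * n * l⁻¹ ∈ N := by
        rintro l hl _ ⟨n, hn, rfl⟩
        exact ⟨⟨l, hl⟩ * n * ⟨l, hl⟩⁻¹, (normalCore_normal _).conj_mem n hn ⟨l, hl⟩, rfl⟩
      refine fun n => ⟨key l hl n, fun h => ?_⟩
      have := key l⁻¹ (L.inv_mem hl) _ h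
      simpa [mul_assoc] using this
    have hN : N₀.map K.subtype ≤ N := by
      have hfin : Finite (L ⧸ K.subgroupOf L) := @finite_quotient_of_finiteIndex _ _ _ ⟨hL0⟩
      let e : L ⧸ K.subgroupOf L ≃ Fin (K.relIndex L) := Finite.equivFin _
      let f : K →* Equiv.Perm (Fin (K.relIndex L)) :=
        (e.permCongrHom.toMonoidHom.comp (MulAction.toPermHom L (L ⧸ K.subgroupOf L))).comp
          (inclusion hKL)
      rintro _ ⟨k, hk, rfl⟩
      have hkf : k ∈ f.ker := (iInf_le (fun p : (c : Fin (B + 1)) × (K →* Equiv.Perm (Fin c)) =>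
        p.2.ker) ⟨⟨K.relIndex L, by omega⟩, f⟩) hk
      refine ⟨inclusion hKL k, ?_, rfl⟩
      rw [SetLike.mem_coe, normalCore_eq_ker, MonoidHom.mem_ker]
      exact e.permCongrHom.injective ((MonoidHom.mem_ker.1 hkf).trans (map_one _).symm)
    exact Set.mem_biUnion (show N ∈ Set.Icc _ K from ⟨hN, hNK⟩) ⟨⟨hN, hNK⟩, hNL, le_inf hLN hLG⟩

end Subgroup

namespace TreeAut

variable {X : Type*}

/-! ### Filtering a level stabilizer by its sections -/

/-- The elements of `st_K(m)` with trivial section at the vertices of `S`. -/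
def partialStab (K : Subgroup (TreeAut X)) {m : ℕ} (S : Set (level X m)) :
    Subgroup (TreeAut X) where
  carrier := {g | g ∈ st K (level X m) ∧ ∀ s ∈ S, g.sectionAt s = 1}
  one_mem' := ⟨Subgroup.one_mem _, fun s _ => sectionAt_one _⟩
  mul_mem' := by
    rintro g h ⟨hg, hg'⟩ ⟨hh, hh'⟩
    refine ⟨Subgroup.mul_mem _ hg hh, fun s hs => ?_⟩
    rw [sectionAt_mul_of_fix (hh.2 _ s.2), hg' s hs, hh' s hs, one_mul]
  inv_mem' := by
    rintro g ⟨hg, hg'⟩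
    refine ⟨Subgroup.inv_mem _ hg, fun s hs => ?_⟩
    rw [sectionAt_inv (hg.2 _ s.2), hg' s hs, inv_one]

theorem mem_partialStab {K : Subgroup (TreeAut X)} {m : ℕ} {S : Set (level X m)} {g : TreeAut X} :
    g ∈ partialStab K S ↔ g ∈ st K (level X m) ∧ ∀ s ∈ S, g.sectionAt s = 1 := Iff.rfl

theorem partialStab_mono {K K' : Subgroup (TreeAut X)} (h : K ≤ K') {m : ℕ}
    (S : Set (level X m)) : partialStab K S ≤ partialStab K' S :=
  fun _ hg => ⟨st_mono h _ hg.1, hg.2⟩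

theorem partialStab_le (K : Subgroup (TreeAut X)) {m : ℕ} (S : Set (level X m)) :
    partialStab K S ≤ K := fun _ hg => hg.1.1

theorem partialStab_empty (K : Subgroup (TreeAut X)) (m : ℕ) :
    partialStab K (∅ : Set (level X m)) = st K (level X m) := by
  ext g
  simp [mem_partialStab]

theorem partialStab_univ [Nonempty X] (K : Subgroup (TreeAut X)) (m : ℕ) :
    partialStab K (Set.univ : Set (level X m)) = ⊥ := by
  rw [eq_bot_iff]
  intro g hg
  rw [Subgroup.mem_bot]
  ext1 x
  by_cases hx : m ≤ x.length
  · have hv : x.take m ∈ level X m := List.length_take_of_le hx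
    have := (sectionAt_eq_one_iff (hg.1.2 _ hv)).1 (hg.2 ⟨_, hv⟩ trivial) (x.drop m)
    rwa [List.take_append_drop] at this
  · exact apply_of_mem_st_level hg.1 (by omega)

/-- Passing from `S` to `insert x S` takes the kernel of the section map at `x`. -/
theorem relIndex_partialStab_le {K K' : Subgroup (TreeAut X)} (hK : K ≤ K') {m : ℕ}
    (S : Set (level X m)) (x : level X m)
    (h₁ : (sec (partialStab K S) x).relIndex (sec (partialStab K' S) x) ≠ 0)
    (h₂ : (partialStab K (insert x S)).relIndex (partialStab K' (insert x S)) ≠ 0) :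
    (partialStab K S).relIndex (partialStab K' S) ≠ 0 ∧
      (partialStab K S).relIndex (partialStab K' S) ≤
        (sec (partialStab K S) x).relIndex (sec (partialStab K' S) x) *
          (partialStab K (insert x S)).relIndex (partialStab K' (insert x S)) := by
  have hle : ∀ (L : Subgroup (TreeAut X)) (S : Set (level X m)),
      partialStab L S ≤ st ⊤ {(x : List X)} := by
    refine fun L S g hg => ⟨trivial, fun y hy => ?_⟩
    rw [Set.mem_singleton_iff.1 hy]
    exact hg.1.2 x x.2
  have hker : ∀ L : Subgroup (TreeAut X),
      (partialStab L S).subgroupOf (st ⊤ {(x : List X)}) ⊓ (vertexHom (x : List X)).ker =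
        (partialStab L (insert x S)).subgroupOf (st ⊤ {(x : List X)}) := by
    intro L
    ext g
    rw [Subgroup.mem_inf, Subgroup.mem_subgroupOf, Subgroup.mem_subgroupOf, mem_partialStab,
      mem_partialStab, MonoidHom.mem_ker, Set.forall_mem_insert, and_assoc,
      and_comm (a := ∀ s ∈ S, _)]
    rfl
  have h := Subgroup.relIndex_le_map_mul_inf_ker (vertexHom (x : List X))
    (H := (partialStab K S).subgroupOf (st ⊤ {(x : List X)}))
    (K := (partialStab K' S).subgroupOf (st ⊤ {(x : List X)}))
    (Subgroup.comap_mono (partialStab_mono hK S)) h₁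
    (by rwa [hker, hker, Subgroup.relIndex_subgroupOf (hle K' _)])
  rwa [hker, hker, Subgroup.relIndex_subgroupOf (hle K' _),
    Subgroup.relIndex_subgroupOf (hle K' _)] at h

theorem relIndex_le_of_forall_relIndex_sec_le [Finite X] [Nonempty X]
    {K K' : Subgroup (TreeAut X)} (hK : K ≤ K') {m b : ℕ}
    (h : ∀ (S : Set (level X m)) (x : level X m),
      (sec (partialStab K S) x).relIndex (sec (partialStab K' S) x) ≠ 0 ∧
        (sec (partialStab K S) x).relIndex (sec (partialStab K' S) x) ≤ b) :
    K.relIndex K' ≠ 0 ∧ K.relIndex K' ≤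
      b ^ Nat.card (level X m) * (st (⊤ : Subgroup (TreeAut X)) (level X m)).index := by
  classical
  have key : ∀ (T : Finset (level X m)) (S : Set (level X m)), S ∪ T = Set.univ →
      (partialStab K S).relIndex (partialStab K' S) ≠ 0 ∧
        (partialStab K S).relIndex (partialStab K' S) ≤ b ^ T.card := by
    intro T
    induction T using Finset.induction_on with
    | empty =>
      intro S hS
      rw [Finset.coe_empty, Set.union_empty] at hS
      rw [hS, partialStab_univ K']
      simp
    | insert x T hx ih =>
      intro S hS
      have h1 := ih (insert x S) (by rw [← hS, Finset.coe_insert, Set.insert_union, Set.union_insert])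
      have h2 := relIndex_partialStab_le hK S x (h S x).1 h1.1
      refine ⟨h2.1, h2.2.trans ?_⟩
      rw [Finset.card_insert_of_notMem hx, pow_succ']
      exact Nat.mul_le_mul (h S x).2 h1.2
  have := Fintype.ofFinite (level X m)
  have h0 := key Finset.univ ∅ (by simp)
  rw [partialStab_empty, partialStab_empty, Finset.card_univ, ← Nat.card_eq_fintype_card] at h0
  have h1 : (st K (level X m)).relIndex K' =
      (st K (level X m)).relIndex (st K' (level X m)) * (st K' (level X m)).relIndex K' :=
    (Subgroup.relIndex_mul_relIndex _ _ _ (st_mono hK _) (st_le _ _)).symm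
  have h2 : (st K (level X m)).relIndex K' ≠ 0 := by
    rw [h1]
    exact mul_ne_zero h0.1 (relIndex_st_level_ne_zero K' m)
  refine ⟨Subgroup.relIndex_ne_zero_of_le (st_le _ _) h2,
    (Subgroup.relIndex_le_of_le_left (st_le _ _) h2).trans ?_⟩
  rw [h1]
  exact Nat.mul_le_mul h0.2 (relIndex_st_level_le K' m)

end TreeAut

theorem Subgroup.exists_le_relIndex_ne_zero_conj_mem {A : Type*} [Group A] {V G : Subgroup A}
    (hV : V.relIndex G ≠ 0) :
    ∃ U ≤ G, U ≤ V ∧ U.relIndex G ≠ 0 ∧ ∀ g ∈ G, ∀ u ∈ U, g * u * g⁻¹ ∈ U := by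
  have hV' : (V.subgroupOf G).FiniteIndex := ⟨hV⟩
  refine ⟨(V.subgroupOf G).normalCore.map G.subtype, map_subtype_le _, ?_, ?_, ?_⟩
  · rintro _ ⟨u, hu, rfl⟩
    exact normalCore_le (V.subgroupOf G) hu
  · rw [relIndex, subgroupOf, comap_map_eq_self_of_injective G.subtype_injective]
    exact FiniteIndex.index_ne_zero
  · rintro g hg _ ⟨u, hu, rfl⟩
    exact ⟨⟨g, hg⟩ * u * ⟨g, hg⟩⁻¹, (normalCore_normal _).conj_mem u hu ⟨g, hg⟩, rfl⟩

namespace TreeAut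

variable {X : Type*}

/-! ### Subgroups with large sections have finite rank -/

/-- The vertices of level `n` active for the sections of the groups `partialStab K S`. -/
def activitySet (K : Subgroup (TreeAut X)) (m n : ℕ) :
    Set ((Set (level X m) × level X m) × level X n) :=
  {p | p.2 ∈ activeVertices (sec (partialStab K p.1.1) p.1.2) n}

theorem mem_activitySet {K : Subgroup (TreeAut X)} {m n : ℕ} {S : Set (level X m)}
    {x : level X m} {v : level X n} :
    ((S, x), v) ∈ activitySet K m n ↔ v ∈ activeVertices (sec (partialStab K S) x) n := Iff.rfl

theorem activitySet_mono {K K' : Subgroup (TreeAut X)} (h : K ≤ K') (m n : ℕ) :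
    activitySet K m n ⊆ activitySet K' m n :=
  fun _ hp => activeVertices_mono (sec_mono (partialStab_mono h _) _) n hp

/-- A normal subgroup of finite index of `G`, contained in all the sections of `st_H(m)` at the
vertices of level `m`. -/
structure IsSectionCore (G H U : Subgroup (TreeAut X)) (m : ℕ) : Prop where
  le : U ≤ G
  relIndex_ne_zero : U.relIndex G ≠ 0
  conj_mem : ∀ g ∈ G, ∀ u ∈ U, g * u * g⁻¹ ∈ U
  le_sec : ∀ x : level X m, U ≤ sec (st H (level X m)) x

theorem exists_isSectionCore [Finite X] {G H : Subgroup (TreeAut X)} {m : ℕ}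
    (h : ∀ x ∈ level X m, (sec H x).relIndex G ≠ 0) : ∃ U, IsSectionCore G H U m := by
  have h1 : ∀ x : level X m, (sec (st H (level X m)) x).relIndex G ≠ 0 := fun x =>
    Subgroup.relIndex_ne_zero_trans (relIndex_sec_ne_zero (relIndex_st_level_ne_zero H m) x)
      (h x x.2)
  obtain ⟨U, hUG, hUV, hU, hconj⟩ := Subgroup.exists_le_relIndex_ne_zero_conj_mem
    (Subgroup.relIndex_iInf_ne_zero h1)
  exact ⟨U, hUG, hU, hconj, fun x => hUV.trans (iInf_le _ x)⟩

/-- An element of `U` is the section of some element of `st_H(m)`, which normalizes `partialStab K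
S`. -/
theorem IsSectionCore.conj_mem_sec {G H U K : Subgroup (TreeAut X)} {m : ℕ}
    (hU : IsSectionCore G H U m) (hHK : H ≤ K) (S : Set (level X m)) (x : level X m) :
    ∀ u ∈ U, ∀ q ∈ sec (partialStab K S) x, u * q * u⁻¹ ∈ sec (partialStab K S) x := by
  intro u hu q hq
  obtain ⟨h, hh, hhx, rfl⟩ := mem_sec.1 (hU.le_sec x hu)
  obtain ⟨g, hg, hgx, rfl⟩ := mem_sec.1 hq
  have hhx' := inv_apply_of_apply hhx
  rw [← sectionAt_inv hhx, ← sectionAt_mul_of_fix hgx, ← sectionAt_mul_of_fix hhx']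
  have hhK : h ∈ st K (level X m) := st_mono hHK _ hh
  refine sectionAt_mem_sec ⟨Subgroup.mul_mem _ (Subgroup.mul_mem _ hhK hg.1)
    (Subgroup.inv_mem _ hhK), fun s hs => ?_⟩ ?_
  · have hhs := hh.2 s s.2
    rw [sectionAt_mul_of_fix (inv_apply_of_apply hhs), sectionAt_mul_of_fix (hg.1.2 s s.2),
      hg.2 s hs, mul_one, sectionAt_inv hhs, mul_inv_cancel]
  · rw [RelIso.mul_apply, RelIso.mul_apply, hhx', hgx, hhx]

theorem IsSectionCore.exists_relIndex_le [Finite X] {G H U K : Subgroup (TreeAut X)} {m n : ℕ}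
    (hG : IsReplicatingJustInfiniteBranch G) (hU : IsSectionCore G H U m)
    (hn : IsTransitiveBelow U n) (hHK : H ≤ K) :
    ∃ B : ℕ, ∀ K' ≤ G, K ≤ K' → activitySet K' m n ⊆ activitySet K m n →
      K.relIndex K' ≠ 0 ∧ K.relIndex K' ≤ B := by
  have := hG.nontrivial
  have h1 : ∀ (S : Set (level X m)) (x : level X m), ∃ B : ℕ, ∀ Q' ≤ G,
      activeVertices Q' n ⊆ activeVertices (sec (partialStab K S) x) n →
        (sec (partialStab K S) x).relIndex Q' ≠ 0 ∧ (sec (partialStab K S) x).relIndex Q' ≤ B :=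
    fun S x => exists_relIndex_le_of_activeVertices_subset hG hU.relIndex_ne_zero hU.le
      hU.conj_mem hn (hU.conj_mem_sec hHK S x)
  choose B hB using h1
  obtain ⟨b, hb⟩ := (Set.finite_range fun p : Set (level X m) × level X m => B p.1 p.2).bddAbove
  refine ⟨b ^ Nat.card (level X m) * (st (⊤ : Subgroup (TreeAut X)) (level X m)).index,
    fun K' hK' hKK' hact => relIndex_le_of_forall_relIndex_sec_le hKK' fun S x => ?_⟩
  have hsub : activeVertices (sec (partialStab K' S) x) n ⊆
      activeVertices (sec (partialStab K S) x) n := fun v hv =>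
    mem_activitySet.1 (hact (mem_activitySet.2 hv))
  have h2 := hB S x _ (sec_le hG.replicating.1 ((partialStab_le K' S).trans hK') x) hsub
  exact ⟨h2.1, h2.2.trans (hb (Set.mem_range_self (S, x)))⟩

/-- The normalizer has no more activity than `N`: a commutator of an element of its filtration with
one of `st_N(m)` lies in the same filtration step of `N`. -/
theorem relIndex_normalizer_ne_zero [Finite X] {G N : Subgroup (TreeAut X)}
    (hG : IsReplicatingJustInfiniteBranch G) (hN : N ≤ G) (hL : HasLargeSections G N) :
    N.relIndex (Subgroup.normalizer N ⊓ G) ≠ 0 := by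
  obtain ⟨m, hm⟩ := hL
  obtain ⟨U, hU⟩ := exists_isSectionCore hm
  obtain ⟨n, hn⟩ := exists_isTransitiveBelow hG hU.relIndex_ne_zero hU.conj_mem
  obtain ⟨B, hB⟩ := hU.exists_relIndex_le hG hn le_rfl
  refine (hB _ inf_le_right (le_inf Subgroup.le_normalizer hN) ?_).1
  rintro ⟨⟨S, x⟩, v⟩ hv
  refine activeVertices_subset_of_commutator_mem hG hU.relIndex_ne_zero ?_ n hv
  intro q hq u hu
  obtain ⟨h, hh, hhx, rfl⟩ := mem_sec.1 (hU.le_sec x hu)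
  obtain ⟨g, hg, hgx, rfl⟩ := mem_sec.1 hq
  have hhx' := inv_apply_of_apply hhx
  have hgx' := inv_apply_of_apply hgx
  rw [← sectionAt_inv hhx, ← sectionAt_inv hgx, ← sectionAt_mul_of_fix hhx,
    ← sectionAt_mul_of_fix hgx', ← sectionAt_mul_of_fix hhx']
  have hgN : g * h * g⁻¹ ∈ N :=
    (Subgroup.mem_normalizer_iff.1 (partialStab_le _ _ hg).1 h).1 hh.1
  refine sectionAt_mem_sec ⟨Subgroup.mul_mem _ (conj_mem_st_level hh hgN)
    (Subgroup.inv_mem _ hh), fun s hs => ?_⟩ ?_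
  · have hhs := hh.2 s s.2
    have hgs := hg.1.2 s s.2
    rw [sectionAt_mul_of_fix (inv_apply_of_apply hhs),
      sectionAt_mul_of_fix (inv_apply_of_apply hgs), sectionAt_mul_of_fix hhs,
      sectionAt_inv hhs, sectionAt_inv hgs, hg.2 s hs, one_mul, inv_one, mul_one, mul_inv_cancel]
  · rw [RelIso.mul_apply, RelIso.mul_apply, RelIso.mul_apply, hhx', hgx', hhx, hgx]

/-- The overgroups of `K` with the same activity are finite in number. -/
theorem IsSectionCore.finite_setOf_activitySet_subset [Finite X] {G H U K : Subgroup (TreeAut X)}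
    {m n : ℕ} (hG : IsReplicatingJustInfiniteBranch G) (hU : IsSectionCore G H U m)
    (hn : IsTransitiveBelow U n) (hH : HasLargeSections G H) (hHK : H ≤ K) (hKG : K ≤ G)
    (hK : K.FG) :
    {L : Subgroup (TreeAut X) | K ≤ L ∧ L ≤ G ∧ activitySet L m n ⊆ activitySet K m n}.Finite := by
  obtain ⟨B, hB⟩ := hU.exists_relIndex_le hG hn hHK
  refine (Subgroup.finite_setOf_relIndex_le (G := G) hK (fun N hNK hN =>
    relIndex_normalizer_ne_zero hG (hNK.trans hKG) ((hH.mono hHK).of_relIndex hN)) B).subset ?_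
  rintro L ⟨hKL, hLG, hact⟩
  exact ⟨hKL, hLG, hB L hLG hKL hact⟩

/-- Among finitely generated groups between `H` and `K`, take one, `L`, of largest activity. Those
above `L` share its activity, so they are finite in number; a maximal one absorbs every element of
`K`. -/
theorem IsSectionCore.fg_of_le [Finite X] {G H U K : Subgroup (TreeAut X)}
    {m n : ℕ} (hG : IsReplicatingJustInfiniteBranch G) (hU : IsSectionCore G H U m)
    (hn : IsTransitiveBelow U n) (hH : HasLargeSections G H) (hHfg : H.FG) (hHK : H ≤ K)
    (hKG : K ≤ G) : K.FG := by
  obtain ⟨L, ⟨hHL, hLK, hL⟩, hmin⟩ := WellFounded.has_min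
    (measure fun L : Subgroup (TreeAut X) => (activitySet L m n)ᶜ.ncard).wf
    {L | H ≤ L ∧ L ≤ K ∧ L.FG} ⟨H, le_rfl, hHK, hHfg⟩
  have hfin := (hU.finite_setOf_activitySet_subset hG hn hH hHL (hLK.trans hKG) hL).subset
    (fun M (hM : M ∈ {M | (L ≤ M ∧ M ≤ G ∧ activitySet M m n ⊆ activitySet L m n) ∧
      M ≤ K ∧ M.FG}) => hM.1)
  obtain ⟨M, hM⟩ := hfin.exists_maximal ⟨L, ⟨le_rfl, hLK.trans hKG, subset_rfl⟩, hLK, hL⟩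
  obtain ⟨⟨hLM, -, -⟩, hMK, hMfg⟩ := hM.prop
  suffices h : K ≤ M by rwa [le_antisymm h hMK]
  intro k hk
  let N := M ⊔ Subgroup.closure {k}
  have hNfg : N.FG := hMfg.sup ⟨{k}, by rw [Finset.coe_singleton]⟩
  have hNK : N ≤ K := sup_le hMK ((Subgroup.closure_le K).2 (Set.singleton_subset_iff.2 hk))
  have hLN : L ≤ N := hLM.trans le_sup_left
  have h1 : (activitySet L m n)ᶜ = (activitySet N m n)ᶜ := by
    refine (Set.eq_of_subset_of_ncard_le
      (Set.compl_subset_compl.2 (activitySet_mono hLN m n)) ?_ (Set.toFinite _)).symm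
    exact not_lt.1 (hmin N ⟨hHL.trans hLN, hNK, hNfg⟩)
  have hNM : N ≤ M := hM.le_of_ge
    ⟨⟨hLN, hNK.trans hKG, (compl_injective h1).ge⟩, hNK, hNfg⟩ le_sup_left
  exact hNM (Subgroup.mem_sup_right (Subgroup.subset_closure rfl))

open CantorBendixson in
theorem IsSectionCore.notMem_iteratedDerivedSet [Finite X] {G H U : Subgroup (TreeAut X)}
    {m n : ℕ} (hG : IsReplicatingJustInfiniteBranch G) (hU : IsSectionCore G H U m)
    (hn : IsTransitiveBelow U n) (hH : HasLargeSections G H) (hHfg : H.FG) (c : ℕ) :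
    ∀ K : Subgroup G, H ≤ K.map G.subtype → (activitySet (K.map G.subtype) m n)ᶜ.ncard < c →
      (show ChabautySpace G from K) ∉
        iteratedDerivedSet (Set.univ : Set (ChabautySpace G)) (c : Ordinal) := by
  induction c with
  | zero => exact fun K _ h => absurd h (Nat.not_lt_zero _)
  | succ c ih =>
    intro K hHK hc hmem
    rw [mem_iteratedDerivedSet_succ, ChabautySpace.mem_derivedSet_iff] at hmem
    have hKG : K.map G.subtype ≤ G := Subgroup.map_subtype_le K
    have hKfg : (K.map G.subtype).FG := hU.fg_of_le hG hn hH hHfg hHK hKG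
    have hW := hU.finite_setOf_activitySet_subset hG hn hH hHK hKG hKfg
    obtain ⟨F₁, hF₁, h₁⟩ := ChabautySpace.exists_finite_forall_le
      (Subgroup.FG.of_map_of_injective G.subtype_injective hKfg)
    have hsep : ∀ L : Subgroup (TreeAut X), ∃ g : G, ¬ L ≤ K.map G.subtype → L ≤ G →
        (g : TreeAut X) ∈ L ∧ g ∉ K := by
      intro L
      by_cases hL : ¬ L ≤ K.map G.subtype ∧ L ≤ G
      · obtain ⟨g, hgL, hgK⟩ := SetLike.not_le_iff_exists.1 hL.1
        exact ⟨⟨g, hL.2 hgL⟩, fun _ _ => ⟨hgL, fun h => hgK ⟨_, h, rfl⟩⟩⟩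
      · exact ⟨1, fun h h' => absurd ⟨h, h'⟩ hL⟩
    choose g hg using hsep
    -- The test set forces `K ≤ K'` and excludes the finitely many proper overgroups of unchanged
    -- activity, so `K'` has fewer inactive entries.
    obtain ⟨K', hK'mem, hne, hK'⟩ := hmem _ (hF₁.union (hW.image g))
    have hle : K ≤ K' := h₁ K' fun x hx => hK' x (Or.inl hx)
    have hle' : K.map G.subtype ≤ K'.map G.subtype := Subgroup.map_mono hle
    have hKG' : K'.map G.subtype ≤ G := Subgroup.map_subtype_le K'
    by_cases hact : activitySet (K'.map G.subtype) m n ⊆ activitySet (K.map G.subtype) m n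
    · have hnle : ¬ K'.map G.subtype ≤ K.map G.subtype := fun h =>
        hne (le_antisymm ((Subgroup.map_le_map_iff_of_injective G.subtype_injective).1 h) hle)
      obtain ⟨h2, h3⟩ := hg _ hnle hKG'
      obtain ⟨k, hk, e⟩ := h2
      refine h3 ((hK' _ (Or.inr ⟨_, ⟨hle', hKG', hact⟩, rfl⟩)).1 ?_)
      rwa [← Subtype.ext (a1 := k) e]
    · refine ih K' (hHK.trans hle') ?_ hK'mem
      have : (activitySet (K'.map G.subtype) m n)ᶜ ⊂ (activitySet (K.map G.subtype) m n)ᶜ :=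
        ⟨Set.compl_subset_compl.2 (activitySet_mono hle' m n),
          fun h => hact (Set.compl_subset_compl.1 h)⟩
      have := Set.ncard_lt_ncard this (Set.toFinite _)
      omega

open CantorBendixson in
theorem HasLargeSections.exists_notMem_iteratedDerivedSet [Finite X] {G : Subgroup (TreeAut X)}
    (hG : IsReplicatingJustInfiniteBranch G) (hfg : G.FG) (K : ChabautySpace G)
    (hK : HasLargeSections G ((show Subgroup G from K).map G.subtype)) :
    ∃ c : ℕ, K ∉ iteratedDerivedSet (Set.univ : Set (ChabautySpace G)) (c : Ordinal) := by
  obtain ⟨m, hm⟩ := hK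
  obtain ⟨H, hHK, hHfg, hH⟩ := HasLargeSections.exists_fg hG.replicating.1 hfg
    (Subgroup.map_subtype_le _) hm
  obtain ⟨U, hU⟩ := exists_isSectionCore hH
  obtain ⟨n, hn⟩ := exists_isTransitiveBelow hG hU.relIndex_ne_zero hU.conj_mem
  exact ⟨_, hU.notMem_iteratedDerivedSet hG hn ⟨m, hH⟩ hHfg _ K hHK (Nat.lt_succ_self _)⟩

end TreeAut

theorem mainTheorem3 {X : Type*} [Finite X] (G : Subgroup (TreeAut X))
    (hfg : G.FG)
    (hbranch : TreeAut.IsBranch G)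
    (hji : IsJustInfinite G)
    (hrep : TreeAut.IsStronglySelfReplicating G)
    (happrox : TreeAut.HasWellApproximatedSubgroups G)
    (hGN : TreeAut.GrigorchukNagnibedaAlternative G) :
    cantorBendixsonRank (ChabautySpace G) = Ordinal.omega0 := by
  have hG : TreeAut.IsReplicatingJustInfiniteBranch G := ⟨hbranch, hji, hrep⟩
  refine cantorBendixsonRank_eq_omega0
    (TreeAut.preperfect_not_hasLargeSections hG happrox hGN) (fun K hK => ?_) (fun n => ?_)
  · exact TreeAut.HasLargeSections.exists_notMem_iteratedDerivedSet hG hfg K (not_not.1 hK)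
  · obtain ⟨H, hH, hmem⟩ := TreeAut.exists_hasLargeSections_mem_iteratedDerivedSet hG n
    exact ⟨H, fun h => h hH, hmem⟩
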